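/- Fix $d,k\in\mathbb N=\{1,2,\dots\}$ and $\gamma=(\gamma_1,\dots,\gamma_{d+1})\in\mathbb R^{d+1}$ with all $\gamma_j>-1$. Put $|\gamma|=\gamma_1+\cdots+\gamma_{d+1}$, $\alpha=\gamma_2+\cdots+\gamma_{d+1}+d-1$, $\beta=\gamma_1$, so that $\alpha+\beta+1=|\gamma|+d$, and assume $|\gamma|+d\notin\{0,1,\dots,k\}$ (that is, the Jacobi polynomials $p_n^{\alpha,\beta-k}$ below have degree exactly $n$ for all $n\ge 0$). Write $\lambda_n^{\xi}=-n(n+\xi)$. **One variable.** Let $$p_n^{a,b}(t)=\frac{(a+b+1)_n}{n!}\,{}_2F_1(-n,\,n+a+b+1;\,a+1;\,1-t)\quad(n\ge 0),\qquad p_n^{a,b}=0\quad(n<0),$$ and $\mathrm{Wr}_n(f^{(1)},\dots,f^{(m)})=\det\big(f^{(i)}_{n-j+1}\big)_{1\le i,j\le m}$. Let $\psi^{(0)},\dots,\psi^{(k-1)}$ be functions of $n\in\mathbb Z$ with $\psi^{(j)}_n\in(-1)^n\mathbb R[\lambda_n^{\alpha+\beta+1}]$, such that $\tau_n=\mathrm{Wr}_n((-1)^n\psi^{(0)}_n,\dots,(-1)^n\psi^{(k-1)}_n)$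 is not identically zero in $n$. Put $q_n=\mathrm{Wr}_n(\psi^{(0)}_n,\dots,\psi^{(k-1)}_n,p_n^{\alpha,\beta}(t))$, and let $\mathfrak A^{\alpha,\beta;\psi}$ be the set of all $f\in\mathbb R[t]$ such that $f(\lambda^{\alpha+\beta+1}_{n-k/2})-f(\lambda^{\alpha+\beta+1}_{n-k/2-1})$ is divisible by $\tau_{n-1}$ in $\mathbb R[n]$. Let $\mathfrak D_\alpha=\mathbb R\langle\mathcal D_1,\mathcal D_2\rangle$ be the algebra generated by $$\mathcal D_1=(t-1)\partial_t,\qquad \mathcal D_2=(1-t)\partial_t^2-(\alpha+1)\partial_t .$$ Finally let $c_{n,k}=(-1)^{nk}$ if $k\equiv 0,3 \pmod 4$ and $c_{n,k}=(-1)^{nk}(2n+\alpha+\beta-k+1)$ if $k\equiv 1,2\pmod 4$. **Several variables.** Let $\hat{\mathfrak D}_\gamma=\mathbb R\langle\hat D_1,\hat D_2\rangle$ be the algebra of partial differential operators in $x_1,\dots,x_d$ generated by $$\hat D_1=(x_1-1)\partial_{x_1}+\sum_{j=2}^d x_j\partial_{x_j},$$ $$\hat D_2=(1-x_1)\partial_{x_1}^2+\sum_{j=2}^d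 x_j\partial_{x_j}^2-2\sum_{j=2}^d x_j\partial_{x_j}\partial_{x_1}-(\gamma_2+\cdots+\gamma_{d+1}+d)\,\partial_{x_1}+\sum_{j=2}^d(\gamma_j+1)\partial_{x_j},$$ and let $$\mathcal M_d^{\gamma}=\sum_{i=1}^d(1-x_i)x_i\partial_{x_i}^2-2\sum_{1\le i<l\le d}x_ix_l\partial_{x_i}\partial_{x_l}+\sum_{i=1}^d\big[(\gamma_i+1)-(|\gamma|+d+1)x_i\big]\partial_{x_i}$$ be the Appell–Lauricella operator (defined by this formula for every $\gamma\in\mathbb R^{d+1}$). **Proposition.** There is an algebra isomorphism $\Phi:\mathfrak D_\alpha\to\hat{\mathfrak D}_\gamma$ with $\Phi(\mathcal D_i)=\hat D_i$ for $i=1,2$. There is $\hat{\mathcal B}_\psi\in\mathfrak D_\alpha$ with $$q_n=c_{n,k}\,\hat{\mathcal B}_\psi\big[p_n^{\alpha,\beta-k}\big]\qquad(n\ge 0),$$ and for every $f\in\mathfrak A^{\alpha,\beta;\psi}$ there is $\mathcal B_f\in\mathfrak D_\alpha$ with $$\mathcal B_f[q_n]=f\big(\lambda^{\alpha+\beta+1}_{n-k/2}\big)\,q_n\qquad(n\ge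 0).$$ For any such $\Phi$, $\hat{\mathcal B}_\psi$, $f$ and $\mathcal B_f$, the partial differential operators $\mathcal B_f(\hat D_1,\hat D_2)=\Phi(\mathcal B_f)$ and $\hat{\mathcal B}_\psi(\hat D_1,\hat D_2)=\Phi(\hat{\mathcal B}_\psi)$ satisfy $$\mathcal B_f(\hat D_1,\hat D_2)\,\hat{\mathcal B}_\psi(\hat D_1,\hat D_2)=\hat{\mathcal B}_\psi(\hat D_1,\hat D_2)\,f\big(\mathcal M_d^{\gamma-k\mathbf e_1}+\lambda_{k/2}^{-|\gamma|-d}\big),\qquad \mathbf e_1=(1,0,\dots,0).$$ That is, $\mathcal B_f(\hat D_1,\hat D_2)$ is a Darboux transformation of $f(\mathcal M_d^{\gamma-k\mathbf e_1}+\lambda_{k/2}^{-|\gamma|-d})$ with intertwiner $\hat{\mathcal B}_\psi(\hat D_1,\hat D_2)$. -/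

import Mathlib

open scoped Polynomial

namespace KrallSimplex

noncomputable section

/-! ### Eigenvalues, discrete Wronskian, Jacobi polynomials -/

/-- `lam ξ n = λ_n^ξ = -n (n + ξ)`. -/
def lam (ξ n : ℝ) : ℝ := -n * (n + ξ)

/-- The Pochhammer symbol `(a)_n = a (a + 1) ⋯ (a + n - 1)`. -/
def poch (a : ℝ) (n : ℕ) : ℝ := (ascPochhammer ℝ n).eval a

/-- The discrete Wronskian `Wr_n(f_0, …, f_{k-1}) = det (f_i(n - j))`, `0 ≤ i, j ≤ k - 1`. -/
def discreteWronskian {R : Type*} [CommRing R] {k : ℕ} (f : Fin k → ℤ → R) (n : ℤ) : R :=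
  Matrix.det (Matrix.of fun i j : Fin k => f i (n - ((j : ℕ) : ℤ)))

/-- The Jacobi polynomial on `[0, 1]`, for the weight `(1 - t) ^ α * t ^ β`, normalized as
`p_n^{α,β}(t) = ((α+β+1)_n / n!) ₂F₁(-n, n+α+β+1; α+1; 1-t)`.
By Pfaff's identity this is
`(-1)^n ((α+β+1)_n / n!) ((β+1)_n / (α+1)_n) ₂F₁(-n, n+α+β+1; β+1; t)` whenever `β` is not a
negative integer; the form used here needs no restriction on `β`. -/
def jacobiNat (α β : ℝ) (n : ℕ) : ℝ[X] :=
  Polynomial.C (poch (α + β + 1) n / (n.factorial : ℝ)) *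
    ∑ j ∈ Finset.range (n + 1),
      Polynomial.C (poch (-(n : ℝ)) j * poch ((n : ℝ) + α + β + 1) j /
        (poch (α + 1) j * (j.factorial : ℝ))) * (1 - Polynomial.X) ^ j

/-- The Jacobi polynomials indexed by `ℤ`, with the convention `p_n = 0` for `n < 0`. -/
def jacobi (α β : ℝ) (n : ℤ) : ℝ[X] :=
  if n < 0 then 0 else jacobiNat α β n.toNat

/-- The extended Jacobi polynomials
`q_n^{α,β;ψ}(t) = Wr_n(ψ^{(0)}, …, ψ^{(k-1)}, p_n^{α,β}(t))`. -/
def qpoly (α β : ℝ) {k : ℕ} (ψ : Fin k → ℤ → ℝ) (n : ℤ) : ℝ[X] :=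
  discreteWronskian
    (Fin.snoc (α := fun _ : Fin (k + 1) => ℤ → ℝ[X])
      (fun j m => Polynomial.C (ψ j m)) (jacobi α β)) n

/-- `τ_n = Wr_n((-1)^n ψ_n^{(0)}, …, (-1)^n ψ_n^{(k-1)})`. -/
def tau {k : ℕ} (ψ : Fin k → ℤ → ℝ) (n : ℤ) : ℝ :=
  discreteWronskian (fun j m => (-1 : ℝ) ^ m * ψ j m) n

/-- `ψ_n ∈ (-1)^n ℝ[λ_n^ξ]`. -/
def IsSignedPoly (ξ : ℝ) (ψ : ℤ → ℝ) : Prop :=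
  ∃ g : ℝ[X], ∀ n : ℤ, ψ n = (-1 : ℝ) ^ n * g.eval (lam ξ n)

/-- The algebra `𝔄^{α,β;ψ}` of all polynomials `f` such that
`f(λ_{n-k/2}) - f(λ_{n-k/2-1})` is divisible by `τ_{n-1}` in `ℝ[n]` (here `λ = λ^{α+β+1}`).
Polynomials in `n` are identified with the functions on `ℤ` that they define. -/
def algA (α β : ℝ) {k : ℕ} (ψ : Fin k → ℤ → ℝ) : Set ℝ[X] :=
  {f | ∃ h : ℝ[X], ∀ n : ℤ,
    f.eval (lam (α + β + 1) ((n : ℝ) - (k : ℝ) / 2)) -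
      f.eval (lam (α + β + 1) ((n : ℝ) - (k : ℝ) / 2 - 1)) = h.eval (n : ℝ) * tau ψ (n - 1)}

/-- The factor `c_{n,k}^s`: it is `(-1)^{nk}` if `k ≡ 0, 3 mod 4`, and
`(-1)^{nk} (2n + s - k + 1)` if `k ≡ 1, 2 mod 4`. -/
def cfac (s : ℝ) (n k : ℕ) : ℝ :=
  if k % 4 = 0 ∨ k % 4 = 3 then (-1 : ℝ) ^ (n * k)
  else (-1 : ℝ) ^ (n * k) * (2 * (n : ℝ) + s - (k : ℝ) + 1)

/-! ### Differential operators in one variable, acting on `ℝ[t]` -/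

/-- The derivative `∂_t`. -/
def dt : Module.End ℝ ℝ[X] := Polynomial.derivative

/-- Multiplication by a polynomial. -/
def mul1 (p : ℝ[X]) : Module.End ℝ ℝ[X] := LinearMap.mulLeft ℝ p

/-- `𝒟₁ = (t - 1) ∂_t`. -/
def D1 : Module.End ℝ ℝ[X] := mul1 (Polynomial.X - 1) * dt

/-- `𝒟₂ = (1 - t) ∂_t² - (α + 1) ∂_t`. -/
def D2 (α : ℝ) : Module.End ℝ ℝ[X] := mul1 (1 - Polynomial.X) * dt ^ 2 - (α + 1) • dt

/-- The associative algebra `𝔇_α = ℝ⟨𝒟₁, 𝒟₂⟩`. -/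
def algD (α : ℝ) : Subalgebra ℝ (Module.End ℝ ℝ[X]) := Algebra.adjoin ℝ {D1, D2 α}

/-- `𝒟₁` as an element of `𝔇_α`. -/
def genD1 (α : ℝ) : algD α := ⟨D1, Algebra.subset_adjoin (Or.inl rfl)⟩

/-- `𝒟₂` as an element of `𝔇_α`. -/
def genD2 (α : ℝ) : algD α := ⟨D2 α, Algebra.subset_adjoin (Or.inr rfl)⟩

/-- `B ∈ 𝔇_α` is the operator `ℬ_f`:
`B[q_n^{α,β;ψ}] = f(λ_{n-k/2}^{α+β+1}) q_n^{α,β;ψ}` for all `n ∈ ℕ₀`. -/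
def IsKrallOperator (α β : ℝ) {k : ℕ} (ψ : Fin k → ℤ → ℝ) (f : ℝ[X]) (B : algD α) : Prop :=
  ∀ n : ℕ, (B : Module.End ℝ ℝ[X]) (qpoly α β ψ n) =
    f.eval (lam (α + β + 1) ((n : ℝ) - (k : ℝ) / 2)) • qpoly α β ψ n

/-- `B ∈ 𝔇_α` is the one-dimensional intertwiner `ℬ̂_ψ`:
`q_n^{α,β;ψ} = c_{n,k}^{α+β} B[p_n^{α,β-k}]` for all `n ∈ ℕ₀`. -/
def IsIntertwiner (α β : ℝ) {k : ℕ} (ψ : Fin k → ℤ → ℝ) (B : algD α) : Prop :=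
  ∀ n : ℕ, qpoly α β ψ n =
    cfac (α + β) n k • (B : Module.End ℝ ℝ[X]) (jacobi α (β - (k : ℝ)) n)

/-! ### Partial differential operators, acting on `ℝ[x₁, …, x_d]`

The variables `x₁, …, x_d` are indexed by `Fin d` (so `x₁` is `X 0`), and `γ₁, …, γ_{d+1}` by
`Fin (d + 1)`; the parameter that goes with the variable `x_j` is `γ j.castSucc`. -/

/-- The partial derivative `∂_{x_j}`. -/
def dx {d : ℕ} (j : Fin d) : Module.End ℝ (MvPolynomial (Fin d) ℝ) :=
  (MvPolynomial.pderiv j : Derivation ℝ _ (MvPolynomial (Fin d) ℝ)).toLinearMap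

/-- Multiplication by a polynomial. -/
def mulx {d : ℕ} (p : MvPolynomial (Fin d) ℝ) : Module.End ℝ (MvPolynomial (Fin d) ℝ) :=
  LinearMap.mulLeft ℝ p

/-- `|γ| = γ₁ + ⋯ + γ_{d+1}`. -/
def absSum {d : ℕ} (γ : Fin (d + 1) → ℝ) : ℝ := ∑ j, γ j

/-- `|γ²| = γ₂ + ⋯ + γ_{d+1}` (the superscript is an index, not a square). -/
def absTail {d : ℕ} (γ : Fin (d + 1) → ℝ) : ℝ := ∑ j : Fin d, γ j.succ

/-- The Appell-Lauricella operator
`ℳ_d^γ = ∑_k (1-x_k) x_k ∂_k² - 2 ∑_{k<l} x_k x_l ∂_k ∂_l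
  + ∑_k [(γ_k+1) - (|γ|+d+1) x_k] ∂_k`. -/
def appellLauricella {d : ℕ} (γ : Fin (d + 1) → ℝ) :
    Module.End ℝ (MvPolynomial (Fin d) ℝ) :=
  ∑ k : Fin d, mulx ((1 - MvPolynomial.X k) * MvPolynomial.X k) * dx k ^ 2
    - (2 : ℝ) • ∑ k : Fin d, ∑ l ∈ Finset.Ioi k,
        mulx (MvPolynomial.X k * MvPolynomial.X l) * (dx k * dx l)
    + ∑ k : Fin d, mulx (MvPolynomial.C (γ k.castSucc + 1)
        - MvPolynomial.C (absSum γ + (d : ℝ) + 1) * MvPolynomial.X k) * dx k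

/-- `D̂₁ = (x₁ - 1) ∂_1 + ∑_{j ≥ 2} x_j ∂_j`. -/
def hatD1 (d : ℕ) [NeZero d] : Module.End ℝ (MvPolynomial (Fin d) ℝ) :=
  mulx (MvPolynomial.X 0 - 1) * dx 0
    + ∑ j ∈ Finset.univ.erase (0 : Fin d), mulx (MvPolynomial.X j) * dx j

/-- `D̂₂ = (1 - x₁) ∂_1² + ∑_{j ≥ 2} x_j ∂_j² - 2 ∑_{j ≥ 2} x_j ∂_j ∂_1
  - (γ₂ + ⋯ + γ_{d+1} + d) ∂_1 + ∑_{j ≥ 2} (γ_j + 1) ∂_j`. -/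
def hatD2 {d : ℕ} [NeZero d] (γ : Fin (d + 1) → ℝ) :
    Module.End ℝ (MvPolynomial (Fin d) ℝ) :=
  mulx (1 - MvPolynomial.X 0) * dx 0 ^ 2
    + ∑ j ∈ Finset.univ.erase (0 : Fin d), mulx (MvPolynomial.X j) * dx j ^ 2
    - (2 : ℝ) • ∑ j ∈ Finset.univ.erase (0 : Fin d), mulx (MvPolynomial.X j) * dx j * dx 0
    - (absTail γ + (d : ℝ)) • dx 0
    + ∑ j ∈ Finset.univ.erase (0 : Fin d), (γ j.castSucc + 1) • dx j

/-- The associative algebra `𝔇̂_γ = ℝ⟨D̂₁, D̂₂⟩`. -/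
def algDhat {d : ℕ} [NeZero d] (γ : Fin (d + 1) → ℝ) :
    Subalgebra ℝ (Module.End ℝ (MvPolynomial (Fin d) ℝ)) :=
  Algebra.adjoin ℝ {hatD1 d, hatD2 γ}

/-- `Φ : 𝔇_α → 𝔇̂_γ` sends `𝒟₁` to `D̂₁` and `𝒟₂` to `D̂₂`. For an algebra isomorphism this
determines `Φ`, and `Φ B` is `B(D̂₁, D̂₂)` for `B = B(𝒟₁, 𝒟₂)`. -/
def SendsGenerators {d : ℕ} [NeZero d] (α : ℝ) (γ : Fin (d + 1) → ℝ)
    (Φ : algD α ≃ₐ[ℝ] algDhat γ) : Prop :=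
  (Φ (genD1 α) : Module.End ℝ (MvPolynomial (Fin d) ℝ)) = hatD1 d ∧
    (Φ (genD2 α) : Module.End ℝ (MvPolynomial (Fin d) ℝ)) = hatD2 γ

/-- `O₂` is obtained from `O₁` by a Darboux transformation with intertwiner `O`. -/
def IsDarboux {V : Type*} [AddCommGroup V] [Module ℝ V] (O₂ O₁ O : Module.End ℝ V) : Prop :=
  O₂ * O = O * O₁

end

end KrallSimplex

open KrallSimplex

/-!
The operators `𝒟₁`, `𝒟₂` and `D̂₁`, `D̂₂` satisfy the same commutation relation
`a * b = b * a - b`, so every element of the algebra generated by a pair is a normally ordered sum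
`∑ⱼ b ^ j * P_j(a)`. On the powers of `1 - t` one sees that such a sum in the `𝒟ᵢ` vanishes only if
all `P_j` do (`normalForm_D_injective`), and on polynomials in `x₁` alone `D̂ᵢ` acts as `𝒟ᵢ`. Hence
the two algebras are isomorphic (`exists_algEquiv`). The isomorphism maps the Jacobi operator
`𝒟₂ - 𝒟₁² - s 𝒟₁` to the Appell–Lauricella operator (`appellLauricella_eq_hatD`).

The intertwiner: put `h_n = (-1)^n p_n^{α,β}`, so that the extended Jacobi polynomial is, up to
sign, `∑ⱼ A_j(n) h_{n-j}` with cofactors `A_j(n)` that are polynomial in `n`. Contiguity relations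
(`signedJacobi_self`, `signedJacobi_pred`) write each `h_{n-j}` as a polynomial in `𝒟₁`, with
coefficients polynomial in `n`, applied to `p_n^{α,β-k}`. The reflection `n ↦ k - s - n`,
`s = α + β + 1`, only reverses the columns of the determinant, so the coefficients are symmetric or
antisymmetric under it, and thus are polynomials in the eigenvalue of `p_n^{α,β-k}`, up to a factor
`2n + s - k` in the antisymmetric case. Replacing the eigenvalue by the Jacobi operator gives an
element of `𝔇_α` (`exists_intertwiner`).

The Krall operator is `P(J) + ∑ᵢ M_i(J) (𝒟₁ + s/2) g_i(J)`, where `J` is the Jacobi operator of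
`p_n^{α,β}` and `ψ^{(i)}_n = (-1)^n g_i(λ_n)`. The operator `𝒟₁ + s/2` acts on the `h_n` as a
summation operator, and the sums that arise are finite bands because
`∑ⱼ A_j(n) g_i(λ_{n-j}) = 0`. Writing `f_n - f_{n-1} = H(n) τ_{n-1}` for `f_n = f(λ_{n-k/2})`, the
coefficients `M_i` come from determinants weighted by `H` (`windowForm`), and the eigenvalue
equation reduces to the determinantal identities `sum_Iio_cofac_mul_windowForm` and
`windowForm_self`. Divisibility by `2n + s`, needed for `M_i`, follows from the reflection
`n ↦ -s - n` (`exists_krallOperator`).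

Finally the Darboux identity in one variable holds on every `p_n^{α,β-k}`, these polynomials span
`ℝ[t]`, and the isomorphism carries the identity to several variables.
-/

/-! ### Normal forms for two generators with `a * b = b * a - b` -/

/-- The normally ordered expression `∑ⱼ b ^ j * P_j(a)`. -/
noncomputable def normalForm {A : Type*} [Ring A] [Algebra ℝ A] (a b : A) :
    (ℕ →₀ ℝ[X]) →ₗ[ℝ] A :=
  Finsupp.lsum ℝ fun j => LinearMap.mulLeft ℝ (b ^ j) ∘ₗ (Polynomial.aeval a).toLinearMap

lemma normalForm_single {A : Type*} [Ring A] [Algebra ℝ A] (a b : A) (j : ℕ) (P : ℝ[X]) :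
    normalForm a b (Finsupp.single j P) = b ^ j * Polynomial.aeval a P := by
  simp [normalForm]

lemma map_normalForm {A B : Type*} [Ring A] [Algebra ℝ A] [Ring B] [Algebra ℝ B] (φ : A →ₐ[ℝ] B)
    (a b : A) (p : ℕ →₀ ℝ[X]) :
    φ (normalForm a b p) = normalForm (φ a) (φ b) p := by
  induction p using Finsupp.induction_linear with
  | zero => simp
  | add p q hp hq => simp [hp, hq]
  | single j P => simp [normalForm_single, Polynomial.aeval_algHom_apply]

lemma mul_pow_of_commutation {A : Type*} [Ring A] {a b : A} (h : a * b = b * a - b) (j : ℕ) :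
    a * b ^ j = b ^ j * (a - (j : A)) := by
  induction j with
  | zero => simp
  | succ j ih =>
    have hc : (j : A) * b = b * j := Nat.cast_comm j b
    calc a * b ^ (j + 1) = a * b ^ j * b := by rw [pow_succ, mul_assoc]
      _ = b ^ j * (a * b - j * b) := by rw [ih, mul_assoc, sub_mul]
      _ = b ^ (j + 1) * (a - ((j + 1 : ℕ) : A)) := by
        rw [h, hc, pow_succ]; push_cast; noncomm_ring

lemma adjoin_le_range_normalForm {A : Type*} [Ring A] [Algebra ℝ A] {a b : A}
    (h : a * b = b * a - b) {x : A} (hx : x ∈ Algebra.adjoin ℝ {a, b}) :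
    ∃ p, normalForm a b p = x := by
  -- Left multiplication by an element of the algebra preserves the range of `normalForm`.
  suffices H : ∀ p, ∃ q, normalForm a b q = x * normalForm a b p by
    obtain ⟨q, hq⟩ := H (Finsupp.single 0 1)
    exact ⟨q, by simpa [normalForm_single] using hq⟩
  induction hx using Algebra.adjoin_induction with
  | mem y hy =>
    intro p
    induction p using Finsupp.induction_linear with
    | zero => exact ⟨0, by simp⟩
    | add p q hp hq =>
      obtain ⟨p', hp'⟩ := hp
      obtain ⟨q', hq'⟩ := hq
      exact ⟨p' + q', by simp [hp', hq', mul_add]⟩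
    | single j P =>
      rcases hy with rfl | rfl
      · refine ⟨Finsupp.single j ((Polynomial.X - (j : ℝ[X])) * P), ?_⟩
        rw [normalForm_single, normalForm_single, ← mul_assoc, mul_pow_of_commutation h]
        simp [mul_assoc]
      · refine ⟨Finsupp.single (j + 1) P, ?_⟩
        rw [normalForm_single, normalForm_single, pow_succ', mul_assoc]
  | algebraMap r => exact fun p => ⟨r • p, by simp [Algebra.smul_def]⟩
  | add y z _ _ hy hz =>
    intro p
    obtain ⟨q, hq⟩ := hy p
    obtain ⟨q', hq'⟩ := hz p
    exact ⟨q + q', by simp [hq, hq', add_mul]⟩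
  | mul y z _ _ hy hz =>
    intro p
    obtain ⟨q, hq⟩ := hz p
    obtain ⟨q', hq'⟩ := hy q
    exact ⟨q', by rw [hq', hq, mul_assoc]⟩

/-! ### The operators `𝒟₁` and `𝒟₂` on the powers of `1 - t` -/

lemma D1_pow (j : ℕ) : D1 ((1 - Polynomial.X) ^ j) = (j : ℝ) • (1 - Polynomial.X : ℝ[X]) ^ j := by
  rcases j with _ | j
  · simp [D1, dt, mul1]
  · simp [D1, dt, mul1, Polynomial.derivative_pow, Polynomial.smul_eq_C_mul]
    ring

lemma D2_pow (α : ℝ) (j : ℕ) : D2 α ((1 - Polynomial.X) ^ j) =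
    ((j : ℝ) * (j + α)) • (1 - Polynomial.X : ℝ[X]) ^ (j - 1) := by
  rcases j with _ | _ | j
  · simp [D2, dt, mul1, pow_two]
  · simp [D2, dt, mul1, Polynomial.smul_eq_C_mul, pow_two]; ring
  · simp [D2, dt, mul1, Polynomial.derivative_pow, Polynomial.smul_eq_C_mul, pow_two]
    ring

/-- Linear maps on `ℝ[t]` are determined by their values on the powers of `1 - t`. -/
lemma end_ext_pow {V : Type*} [AddCommGroup V] [Module ℝ V] {S T : ℝ[X] →ₗ[ℝ] V}
    (h : ∀ j : ℕ, S ((1 - Polynomial.X) ^ j) = T ((1 - Polynomial.X) ^ j)) : S = T := by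
  ext q
  simp only [LinearMap.coe_comp, Function.comp_apply]
  generalize Polynomial.monomial q (1 : ℝ) = r
  obtain ⟨r, rfl⟩ : ∃ r' : ℝ[X], r = r'.comp (1 - Polynomial.X) :=
    ⟨r.comp (1 - Polynomial.X), by simp [Polynomial.comp_assoc]⟩
  induction r using Polynomial.induction_on' with
  | add p q hp hq => simp [hp, hq]
  | monomial n c =>
    rw [Polynomial.monomial_comp, ← Polynomial.smul_eq_C_mul, map_smul, map_smul, h]

lemma D1_mul_D2 (α : ℝ) : D1 * D2 α = D2 α * D1 - D2 α := by
  refine end_ext_pow fun j => ?_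
  rcases j with _ | j
  · have h1 := D1_pow 0
    have h2 := D2_pow α 0
    simp only [pow_zero, Nat.cast_zero, zero_mul, zero_smul] at h1 h2
    simp [h1, h2]
  · simp only [Module.End.mul_apply, D2_pow, D1_pow, map_smul, LinearMap.sub_apply, smul_smul,
      ← sub_smul]
    congr 1
    simp
    ring

lemma aeval_apply_of_eigen {V : Type*} [AddCommGroup V] [Module ℝ V] {T : Module.End ℝ V} {v : V}
    {c : ℝ} (h : T v = c • v) (P : ℝ[X]) : Polynomial.aeval T P v = P.eval c • v := by
  induction P using Polynomial.induction_on' with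
  | add p q hp hq => simp [hp, hq, add_smul]
  | monomial n r =>
    have : ∀ n : ℕ, (T ^ n) v = c ^ n • v := by
      intro n
      induction n with
      | zero => simp
      | succ n ih => rw [pow_succ, Module.End.mul_apply, h, map_smul, ih, smul_smul, pow_succ']
    simp [Polynomial.aeval_monomial, this, smul_smul, mul_comm r]

lemma D2_iterate_pow (α : ℝ) (m j : ℕ) : (D2 α ^ j) ((1 - Polynomial.X) ^ m) =
    (∏ i ∈ Finset.range j, (((m - i : ℕ) : ℝ) * ((m - i : ℕ) + α))) •
      (1 - Polynomial.X : ℝ[X]) ^ (m - j) := by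
  induction j with
  | zero => simp
  | succ j ih =>
    rw [pow_succ', Module.End.mul_apply, ih, map_smul, D2_pow, smul_smul, Finset.prod_range_succ,
      Nat.sub_sub]

/-- There is no relation between `𝒟₁` and `𝒟₂` besides the commutation relation: `b ^ j * P_j(a)`
maps `(1-t) ^ m` to `P_j(m) (1-t) ^ (m-j)` times a number that vanishes only for `m < j`. -/
lemma normalForm_D_injective {α : ℝ} (hα : -1 < α) {p : ℕ →₀ ℝ[X]}
    (h : normalForm D1 (D2 α) p = 0) : p = 0 := by
  ext1 j
  have key : ∀ m : ℕ, j ≤ m → (p j).eval (m : ℝ) = 0 := by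
    intro m hm
    have h1 : ∀ p : ℕ →₀ ℝ[X], ((normalForm D1 (D2 α) p ((1 - Polynomial.X) ^ m)).comp
        (1 - Polynomial.X)).coeff (m - j) = (p j).eval (m : ℝ) *
          ∏ i ∈ Finset.range j, (((m - i : ℕ) : ℝ) * ((m - i : ℕ) + α)) := by
      intro p
      induction p using Finsupp.induction_linear with
      | zero => simp
      | add p q hp hq => simp [hp, hq, add_mul]
      | single i P =>
        rw [normalForm_single, Module.End.mul_apply, aeval_apply_of_eigen (D1_pow m), map_smul,
          D2_iterate_pow, smul_smul]
        simp only [Polynomial.smul_comp, Polynomial.pow_comp, Polynomial.sub_comp,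
          Polynomial.one_comp, Polynomial.X_comp, sub_sub_cancel, Polynomial.coeff_smul,
          Polynomial.coeff_X_pow, smul_eq_mul]
        rcases eq_or_ne i j with rfl | hij
        · simp
        · rw [Finsupp.single_eq_of_ne' hij]
          rcases le_or_gt i m with him | him
          · rw [if_neg (by omega)]; simp
          · rw [Finset.prod_eq_zero (i := m) (by simpa using him) (by simp)]; simp
    have h2 := h1 p
    rw [h] at h2
    simp only [LinearMap.zero_apply, Polynomial.zero_comp, Polynomial.coeff_zero] at h2
    refine (mul_eq_zero.mp h2.symm).resolve_right ?_
    refine Finset.prod_ne_zero_iff.mpr fun i hi => ?_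
    have : (1 : ℝ) ≤ ((m - i : ℕ) : ℝ) := by
      have := Finset.mem_range.mp hi
      exact_mod_cast (by omega : 1 ≤ m - i)
    exact mul_ne_zero (by linarith) (by linarith)
  refine Polynomial.eq_zero_of_infinite_isRoot _ (Set.Infinite.mono ?_
    ((Set.Ici_infinite j).image (Nat.cast_injective (R := ℝ)).injOn))
  rintro _ ⟨m, hm, rfl⟩
  exact key m hm

/-! ### The isomorphism `𝔇_α ≃ 𝔇̂_γ` and the Appell–Lauricella operator -/

section Several

variable {d : ℕ}

lemma sum_sum_eq_diag_add_two_smul {V : Type*} [AddCommGroup V] [Module ℝ V]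
    {f : Fin d → Fin d → V} (hf : ∀ i j, f i j = f j i) :
    ∑ i, ∑ j, f i j = ∑ i, f i i + (2 : ℝ) • ∑ i, ∑ j ∈ Finset.Ioi i, f i j := by
  have h1 : ∀ i, ∑ j, f i j = f i i + (∑ j ∈ Finset.Ioi i, f i j + ∑ j ∈ Finset.Iio i, f i j) := by
    intro i
    rw [← Finset.add_sum_erase _ _ (Finset.mem_univ i), ← Finset.sum_union]
    · congr 2
      ext j
      simp [lt_or_lt_iff_ne, eq_comm]
    · exact Finset.disjoint_left.mpr fun j hj hj' =>
        lt_asymm (Finset.mem_Ioi.mp hj) (Finset.mem_Iio.mp hj')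
  have h2 : ∑ i, ∑ j ∈ Finset.Iio i, f i j = ∑ i, ∑ j ∈ Finset.Ioi i, f i j := by
    rw [Finset.sum_comm' (s' := fun j => Finset.Ioi j) (t' := Finset.univ) (by simp)]
    exact Finset.sum_congr rfl fun i _ => Finset.sum_congr rfl fun j _ => hf _ _
  rw [Finset.sum_congr rfl fun i _ => h1 i, Finset.sum_add_distrib, Finset.sum_add_distrib, h2,
    two_smul]

/-- The Euler operator `∑ⱼ x_j ∂_j`. -/
noncomputable def euler (d : ℕ) : Module.End ℝ (MvPolynomial (Fin d) ℝ) :=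
  ∑ j, mulx (MvPolynomial.X j) * dx j

/-- The part `∑ⱼ (x_j ∂_j² + (γ_j + 1) ∂_j)` of the Appell–Lauricella operator, which lowers the
degree by one. -/
noncomputable def lowering (γ : Fin (d + 1) → ℝ) : Module.End ℝ (MvPolynomial (Fin d) ℝ) :=
  ∑ j, (mulx (MvPolynomial.X j) * dx j ^ 2 + (γ j.castSucc + 1) • dx j)

lemma dx_mul_mulx_X (i j : Fin d) : dx i * mulx (MvPolynomial.X j : MvPolynomial (Fin d) ℝ) =
    mulx (MvPolynomial.X j) * dx i + if i = j then 1 else 0 := by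
  refine LinearMap.ext fun p => ?_
  rcases eq_or_ne i j with rfl | h
  · simp [dx, mulx]
  · simp [dx, mulx, MvPolynomial.pderiv_X, h, h.symm]

lemma dx_commute (i j : Fin d) : (dx i : Module.End ℝ (MvPolynomial (Fin d) ℝ)) * dx j =
    dx j * dx i := by
  have h : ⁅(MvPolynomial.pderiv i : Derivation ℝ (MvPolynomial (Fin d) ℝ) _),
      (MvPolynomial.pderiv j : Derivation ℝ (MvPolynomial (Fin d) ℝ) _)⁆ = 0 := by
    refine MvPolynomial.derivation_ext fun l => ?_
    simp [Derivation.commutator_apply, MvPolynomial.pderiv_X, Pi.single_apply, apply_ite]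
  refine LinearMap.ext fun p => sub_eq_zero.mp ?_
  simpa [Derivation.commutator_apply, dx] using congrArg (fun D => D p) h

lemma mulx_mul (p q : MvPolynomial (Fin d) ℝ) : mulx (p * q) = mulx p * mulx q := by
  refine LinearMap.ext fun r => ?_
  simp [mulx]

lemma dx_mul_euler (i : Fin d) : dx i * euler d = euler d * dx i + dx i := by
  simp only [euler, Finset.mul_sum, Finset.sum_mul, ← mul_assoc, dx_mul_mulx_X, add_mul,
    Finset.sum_add_distrib]
  simp [mul_assoc, dx_commute i]

lemma euler_mul_mulx_X (i : Fin d) : euler d * mulx (MvPolynomial.X i) =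
    mulx (MvPolynomial.X i) * euler d + mulx (MvPolynomial.X i) := by
  simp only [euler, Finset.mul_sum, Finset.sum_mul, mul_assoc, dx_mul_mulx_X, mul_add,
    Finset.sum_add_distrib]
  simp [← mul_assoc, ← mulx_mul, mul_comm (MvPolynomial.X i)]

lemma euler_mul_lowering (γ : Fin (d + 1) → ℝ) :
    euler d * lowering γ = lowering γ * euler d - lowering γ := by
  simp only [lowering, Finset.mul_sum, Finset.sum_mul, ← Finset.sum_sub_distrib]
  refine Finset.sum_congr rfl fun i _ => ?_
  have h1 : euler d * dx i = dx i * euler d - dx i := by rw [dx_mul_euler]; abel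
  have h2 := euler_mul_mulx_X i
  rw [mul_add, add_mul, ← mul_assoc, h2, pow_two, add_mul, mul_assoc (mulx _) (euler d),
    ← mul_assoc (euler d) (dx i), h1, sub_mul, mul_assoc (dx i) (euler d), h1,
    mul_smul_comm, h1, smul_mul_assoc]
  simp only [smul_sub, mul_sub, mul_assoc]
  abel

lemma dx_mul_lowering (γ : Fin (d + 1) → ℝ) (i : Fin d) :
    dx i * lowering γ = lowering γ * dx i + dx i ^ 2 := by
  have h : ∀ j, dx i * (mulx (MvPolynomial.X j) * dx j ^ 2 + (γ j.castSucc + 1) • dx j) =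
      (mulx (MvPolynomial.X j) * dx j ^ 2 + (γ j.castSucc + 1) • dx j) * dx i +
        if i = j then dx i ^ 2 else 0 := by
    intro j
    have h3 : dx i * dx j ^ 2 = dx j ^ 2 * dx i := by
      rw [pow_two, ← mul_assoc, dx_commute i, mul_assoc, dx_commute i, ← mul_assoc]
    rw [mul_add, add_mul, ← mul_assoc, dx_mul_mulx_X, add_mul, mul_assoc, h3, mul_smul_comm,
      dx_commute i, smul_mul_assoc, mul_assoc]
    split_ifs with hij
    · subst hij; rw [one_mul]; abel
    · simp
  rw [lowering, Finset.mul_sum, Finset.sum_mul, Finset.sum_congr rfl fun j _ => h j,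
    Finset.sum_add_distrib]
  simp

lemma appellLauricella_eq (γ : Fin (d + 1) → ℝ) : appellLauricella γ =
    lowering γ - euler d * euler d - (absSum γ + (d : ℝ)) • euler d := by
  have h1 : euler d * euler d = ∑ i, ∑ j, mulx (MvPolynomial.X i * MvPolynomial.X j) *
      (dx i * dx j) + euler d := by
    nth_rw 1 [euler]
    rw [Finset.sum_mul]
    simp only [mul_assoc, dx_mul_euler, mul_add, Finset.sum_add_distrib]
    congr 1
    refine Finset.sum_congr rfl fun i _ => ?_
    rw [euler, Finset.sum_mul, Finset.mul_sum]
    refine Finset.sum_congr rfl fun j _ => ?_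
    rw [mulx_mul, dx_commute i j]
    noncomm_ring
  rw [sum_sum_eq_diag_add_two_smul fun i j => by
    rw [mul_comm (MvPolynomial.X i), dx_commute i]] at h1
  have h2 : ∀ k : Fin d, mulx ((1 - MvPolynomial.X k) * MvPolynomial.X k : MvPolynomial _ ℝ) *
      dx k ^ 2 = mulx (MvPolynomial.X k) * dx k ^ 2 -
        mulx (MvPolynomial.X k * MvPolynomial.X k) * (dx k * dx k) := by
    intro k
    refine LinearMap.ext fun p => ?_
    simp [mulx, pow_two]
    ring
  have h3 : ∀ k : Fin d, mulx (MvPolynomial.C (γ k.castSucc + 1) -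
      MvPolynomial.C (absSum γ + (d : ℝ) + 1) * MvPolynomial.X k) * dx k =
      (γ k.castSucc + 1) • dx k - (absSum γ + (d : ℝ) + 1) • (mulx (MvPolynomial.X k) * dx k) := by
    intro k
    refine LinearMap.ext fun p => ?_
    simp [mulx, MvPolynomial.smul_eq_C_mul]
    ring
  rw [appellLauricella, h1, lowering, Finset.sum_add_distrib, Finset.sum_congr rfl fun k _ => h2 k,
    Finset.sum_congr rfl fun k _ => h3 k, Finset.sum_sub_distrib, Finset.sum_sub_distrib,
    ← Finset.smul_sum, ← euler]
  module

variable [NeZero d]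

lemma hatD1_eq : hatD1 d = euler d - dx 0 := by
  have h : mulx (MvPolynomial.X 0 - 1 : MvPolynomial (Fin d) ℝ) = mulx (MvPolynomial.X 0) - 1 := by
    refine LinearMap.ext fun p => ?_; simp [mulx, sub_mul]
  rw [hatD1, euler, ← Finset.add_sum_erase _ _ (Finset.mem_univ 0), h, sub_mul, one_mul]
  abel

lemma hatD2_eq (γ : Fin (d + 1) → ℝ) : hatD2 γ = lowering γ - (2 : ℝ) • (euler d * dx 0) +
    dx 0 ^ 2 - (absSum γ + (d : ℝ) + 1) • dx 0 := by
  have h : mulx (1 - MvPolynomial.X 0 : MvPolynomial (Fin d) ℝ) = 1 - mulx (MvPolynomial.X 0) := by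
    refine LinearMap.ext fun p => ?_; simp [mulx, sub_mul]
  have hs : absSum γ = γ 0 + absTail γ := by simp [absSum, absTail, Fin.sum_univ_succ]
  rw [hatD2, euler, lowering, ← Finset.add_sum_erase _ _ (Finset.mem_univ 0),
    ← Finset.add_sum_erase (a := (0 : Fin d)) _ (fun j => mulx (MvPolynomial.X j) * dx j)
      (Finset.mem_univ 0), h, hs, Finset.sum_add_distrib, add_mul, Finset.sum_mul,
    Fin.castSucc_zero']
  simp only [sub_mul, one_mul, mul_assoc, pow_two]
  module

lemma hatD1_mul_hatD2 (γ : Fin (d + 1) → ℝ) : hatD1 d * hatD2 γ = hatD2 γ * hatD1 d - hatD2 γ := by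
  have h1 : dx 0 * euler d = euler d * dx 0 + dx 0 := dx_mul_euler 0
  have h2 := euler_mul_lowering γ
  have h3 : dx 0 * lowering γ = lowering γ * dx 0 + dx 0 ^ 2 := dx_mul_lowering γ 0
  rw [hatD1_eq, hatD2_eq]
  generalize absSum γ + (d : ℝ) + 1 = c
  generalize euler d = e at *
  generalize lowering γ = l at *
  generalize dx (0 : Fin d) = x at *
  simp only [pow_two] at *
  simp only [sub_mul, mul_sub, add_mul, mul_add, mul_smul_comm, smul_mul_assoc, mul_assoc, h1,
    h2, h3]
  simp only [← mul_assoc, h1]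
  simp only [add_mul, mul_assoc]
  simp only [← mul_assoc]
  module

lemma appellLauricella_eq_hatD (γ : Fin (d + 1) → ℝ) (r : ℝ) :
    appellLauricella (γ - Pi.single 0 r) =
      hatD2 γ - hatD1 d ^ 2 - (absSum γ + (d : ℝ) - r) • hatD1 d := by
  have h1 : dx 0 * euler d = euler d * dx 0 + dx 0 := dx_mul_euler 0
  have h2 : absSum (γ - Pi.single 0 r) = absSum γ - r := by
    simp [absSum, Finset.sum_sub_distrib]
  have h3 : lowering (γ - Pi.single 0 r) = lowering γ - r • dx 0 := by
    have : ∀ j : Fin d, (Pi.single 0 r : Fin (d + 1) → ℝ) j.castSucc = if j = 0 then r else 0 := by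
      intro j
      rw [Pi.single_apply]
      congr 1
      exact propext Fin.castSucc_eq_zero_iff
    have h4 : ∀ j : Fin d, ((γ - Pi.single 0 r : Fin (d + 1) → ℝ) j.castSucc + 1) • dx j =
        (γ j.castSucc + 1) • dx j - if j = 0 then r • dx j else 0 := by
      intro j
      rw [Pi.sub_apply, this]
      split_ifs
      · module
      · simp
    simp only [lowering, h4, ← add_sub_assoc, Finset.sum_sub_distrib]
    simp
  rw [appellLauricella_eq, h2, h3, hatD1_eq, hatD2_eq]
  simp only [pow_two, sub_mul, mul_sub, h1]
  module

/-- The inclusion `ℝ[t] → ℝ[x₁, …, x_d]`, `t ↦ x₁`. -/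
noncomputable def inclX (d : ℕ) [NeZero d] : ℝ[X] →ₐ[ℝ] MvPolynomial (Fin d) ℝ :=
  Polynomial.aeval (MvPolynomial.X 0)

lemma inclX_injective : Function.Injective (inclX d) :=
  transcendental_iff_injective.mp (MvPolynomial.transcendental_X ℝ 0)

lemma dx_inclX (j : Fin d) (q : ℝ[X]) :
    dx j (inclX d q) = if j = 0 then inclX d (Polynomial.derivative q) else 0 := by
  change MvPolynomial.pderiv j (Polynomial.aeval _ q) = _
  rw [Derivation.map_aeval, MvPolynomial.pderiv_X, Pi.single_apply]
  split_ifs <;> simp_all [inclX]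

lemma hatD1_inclX (q : ℝ[X]) : hatD1 d (inclX d q) = inclX d (D1 q) := by
  have h : ∀ j ∈ Finset.univ.erase (0 : Fin d),
      (mulx (MvPolynomial.X j) * dx j) (inclX d q) = 0 := by
    intro j hj
    simp [dx_inclX, Finset.ne_of_mem_erase hj]
  simp only [hatD1, LinearMap.add_apply, LinearMap.sum_apply, Finset.sum_eq_zero h, add_zero]
  simp [dx_inclX, D1, dt, mul1, mulx]
  simp [inclX]

lemma hatD2_inclX (γ : Fin (d + 1) → ℝ) (q : ℝ[X]) :
    hatD2 γ (inclX d q) = inclX d (D2 (absTail γ + d - 1) q) := by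
  have h1 : ∀ j ∈ Finset.univ.erase (0 : Fin d),
      (mulx (MvPolynomial.X j) * dx j ^ 2) (inclX d q) = 0 := by
    intro j hj
    simp [dx_inclX, Finset.ne_of_mem_erase hj, pow_two]
  have h2 : ∀ j ∈ Finset.univ.erase (0 : Fin d),
      (mulx (MvPolynomial.X j) * dx j * dx 0 : Module.End ℝ _) (inclX d q) = 0 := by
    intro j hj
    simp [dx_inclX, Finset.ne_of_mem_erase hj]
  simp only [hatD2, LinearMap.add_apply, LinearMap.sub_apply, LinearMap.smul_apply,
    LinearMap.sum_apply, Finset.sum_eq_zero h1, Finset.sum_eq_zero h2]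
  simp [dx_inclX, D2, dt, mul1, mulx, pow_two]
  simp [inclX]

/-- The subalgebra of `End ℝ[t] × End ℝ[x]` generated by the pairs `(𝒟ᵢ, D̂ᵢ)`. It is the graph
of the isomorphism `𝔇_α ≃ 𝔇̂_γ`. -/
noncomputable def algPair (α : ℝ) (γ : Fin (d + 1) → ℝ) :
    Subalgebra ℝ (Module.End ℝ ℝ[X] × Module.End ℝ (MvPolynomial (Fin d) ℝ)) :=
  Algebra.adjoin ℝ {(D1, hatD1 d), (D2 α, hatD2 γ)}

/-- The first projection is injective on `algPair`, because a normally ordered expression in the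
`𝒟ᵢ` determines its coefficients. -/
lemma eq_zero_of_mem_algPair {α : ℝ} (hα : -1 < α) {γ : Fin (d + 1) → ℝ}
    {x : Module.End ℝ ℝ[X] × Module.End ℝ (MvPolynomial (Fin d) ℝ)} (hx : x ∈ algPair α γ)
    (h : x.1 = 0) : x = 0 := by
  have hc : ((D1, hatD1 d) : Module.End ℝ ℝ[X] × Module.End ℝ (MvPolynomial (Fin d) ℝ)) *
      (D2 α, hatD2 γ) = (D2 α, hatD2 γ) * (D1, hatD1 d) - (D2 α, hatD2 γ) :=
    Prod.ext (D1_mul_D2 α) (hatD1_mul_hatD2 γ)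
  obtain ⟨p, rfl⟩ := adjoin_le_range_normalForm hc hx
  have h1 := map_normalForm (AlgHom.fst ℝ (Module.End ℝ ℝ[X])
    (Module.End ℝ (MvPolynomial (Fin d) ℝ))) (D1, hatD1 d) (D2 α, hatD2 γ) p
  rw [normalForm_D_injective hα (h1.symm.trans h), map_zero]

lemma snd_inclX_of_mem_algPair {α : ℝ} {γ : Fin (d + 1) → ℝ} (hα : α = absTail γ + (d : ℝ) - 1)
    {x : Module.End ℝ ℝ[X] × Module.End ℝ (MvPolynomial (Fin d) ℝ)} (hx : x ∈ algPair α γ)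
    (q : ℝ[X]) : x.2 (inclX d q) = inclX d (x.1 q) := by
  induction hx using Algebra.adjoin_induction generalizing q with
  | mem y hy =>
    rcases hy with rfl | rfl
    · exact hatD1_inclX q
    · subst hα; exact hatD2_inclX γ q
  | algebraMap r => simp [Module.algebraMap_end_apply]
  | add y z _ _ hy hz => simp [hy, hz]
  | mul y z _ _ hy hz => simp [hy, hz]

/-- Both coordinate projections of `algPair` are bijective onto their images: a normally ordered
expression in the `𝒟ᵢ` vanishes only if its coefficients do, and `D̂ᵢ` restricts to `𝒟ᵢ` on the
polynomials in `x₁`. -/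
lemma exists_algEquiv {α : ℝ} (hα' : -1 < α) {γ : Fin (d + 1) → ℝ}
    (hα : α = absTail γ + (d : ℝ) - 1) :
    ∃ Φ : algD α ≃ₐ[ℝ] algDhat γ, SendsGenerators α γ Φ := by
  have h1 : (algPair α γ).map (AlgHom.fst ℝ _ _) = algD α := by
    rw [algPair, AlgHom.map_adjoin, algD]; simp [Set.image_pair]
  have h2 : (algPair α γ).map (AlgHom.snd ℝ _ _) = algDhat γ := by
    rw [algPair, AlgHom.map_adjoin, algDhat]; simp [Set.image_pair]
  let f1 : algPair α γ →ₐ[ℝ] algD α :=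
    ((AlgHom.fst ℝ _ _).comp (algPair α γ).val).codRestrict _
      fun x => h1 ▸ Subalgebra.mem_map.mpr ⟨x, x.2, rfl⟩
  let f2 : algPair α γ →ₐ[ℝ] algDhat γ :=
    ((AlgHom.snd ℝ _ _).comp (algPair α γ).val).codRestrict _
      fun x => h2 ▸ Subalgebra.mem_map.mpr ⟨x, x.2, rfl⟩
  have b1 : Function.Bijective f1 := by
    refine ⟨fun x y hxy => Subtype.ext (sub_eq_zero.mp ?_), fun y => ?_⟩
    · exact eq_zero_of_mem_algPair hα' (sub_mem x.2 y.2)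
        (sub_eq_zero.mpr (congrArg Subtype.val hxy))
    · obtain ⟨x, hx, hxy⟩ := Subalgebra.mem_map.mp (h1.symm ▸ y.2 :
        (y : Module.End ℝ ℝ[X]) ∈ (algPair α γ).map (AlgHom.fst ℝ _ _))
      exact ⟨⟨x, hx⟩, Subtype.ext hxy⟩
  have b2 : Function.Bijective f2 := by
    refine ⟨fun x y hxy => Subtype.ext (sub_eq_zero.mp ?_), fun y => ?_⟩
    · have hz := sub_mem x.2 y.2
      have hz2 : (x.1 - y.1).2 = 0 := sub_eq_zero.mpr (congrArg Subtype.val hxy)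
      refine eq_zero_of_mem_algPair hα' hz (LinearMap.ext fun q => inclX_injective (d := d) ?_)
      rw [← snd_inclX_of_mem_algPair hα hz, hz2]
      simp
    · obtain ⟨x, hx, hxy⟩ := Subalgebra.mem_map.mp (h2.symm ▸ y.2 :
        (y : Module.End ℝ (MvPolynomial (Fin d) ℝ)) ∈ (algPair α γ).map (AlgHom.snd ℝ _ _))
      exact ⟨⟨x, hx⟩, Subtype.ext hxy⟩
  have e1 : (AlgEquiv.ofBijective f1 b1).symm (genD1 α) =
      ⟨(D1, hatD1 d), Algebra.subset_adjoin (Or.inl rfl)⟩ := by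
    rw [AlgEquiv.symm_apply_eq]; rfl
  have e2 : (AlgEquiv.ofBijective f1 b1).symm (genD2 α) =
      ⟨(D2 α, hatD2 γ), Algebra.subset_adjoin (Or.inr rfl)⟩ := by
    rw [AlgEquiv.symm_apply_eq]; rfl
  refine ⟨(AlgEquiv.ofBijective f1 b1).symm.trans (AlgEquiv.ofBijective f2 b2), ?_, ?_⟩
  · rw [AlgEquiv.trans_apply, e1]; rfl
  · rw [AlgEquiv.trans_apply, e2]; rfl

end Several

/-! ### Jacobi polynomials -/

/-- The operator `𝒟₂ - 𝒟₁² - s 𝒟₁`, for `s = α + β + 1` the Jacobi operator of `p_n^{α,β}`. -/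
noncomputable def jacobiOp (α s : ℝ) : Module.End ℝ ℝ[X] := D2 α - D1 ^ 2 - s • D1

/-- `(-1)^(n+j) (s)_{n+j} / (n-j)!`: up to the factor `1 / ((α+1)_j j!)`, the coefficient of
`(1-t)^j` in `(-1)^n p_n^{α,β}`, where `s = α + β + 1`. It is zero unless `0 ≤ j ≤ n`. -/
noncomputable def jacCoeff (s : ℝ) (n : ℤ) (j : ℕ) : ℝ :=
  if (j : ℤ) ≤ n then (-1) ^ (n.toNat + j) * poch s (n.toNat + j) / ((n.toNat - j).factorial : ℝ)
  else 0

/-- The signed Jacobi polynomial `(-1)^n p_n^{α,β}`. -/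
noncomputable def signedJacobi (α β : ℝ) (n : ℤ) : ℝ[X] := (-1 : ℝ) ^ n • jacobi α β n

lemma poch_succ (s : ℝ) (n : ℕ) : poch s (n + 1) = poch s n * (s + n) := by
  simp [poch, ascPochhammer_succ_eval]

lemma poch_succ_left (s : ℝ) (n : ℕ) : poch s (n + 1) = s * poch (s + 1) n := by
  simp [poch, ascPochhammer_succ_left, Polynomial.eval_comp]

lemma poch_add (s : ℝ) (n m : ℕ) : poch s (n + m) = poch s n * poch (s + n) m := by
  induction m with
  | zero => simp [poch]
  | succ m ih => rw [← add_assoc, poch_succ, ih, poch_succ]; push_cast; ring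

lemma poch_ne_zero {s : ℝ} {n : ℕ} (h : ∀ i < n, s + i ≠ 0) : poch s n ≠ 0 := by
  induction n with
  | zero => simp [poch]
  | succ n ih =>
    rw [poch_succ]
    exact mul_ne_zero (ih fun i hi => h i (by omega)) (h n (by omega))

lemma poch_neg (n j : ℕ) (h : j ≤ n) :
    poch (-(n : ℝ)) j * ((n - j).factorial : ℝ) = (-1) ^ j * (n.factorial : ℝ) := by
  induction j with
  | zero => simp [poch]
  | succ j ih =>
    have h1 : (n - j).factorial = (n - j) * (n - (j + 1)).factorial := by
      rw [show n - j = (n - (j + 1)) + 1 by omega, Nat.factorial_succ]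
    have h2 : ((n - j : ℕ) : ℝ) = n - j := Nat.cast_sub (by omega)
    have := ih (by omega)
    rw [h1] at this
    push_cast [h2] at this
    rw [poch_succ, pow_succ]
    linear_combination -this

lemma jacCoeff_natCast_add (s : ℝ) (m j : ℕ) : jacCoeff s ((m + j : ℕ) : ℤ) j =
    (-1) ^ m * poch s (m + j + j) / (m.factorial : ℝ) := by
  rw [jacCoeff, if_pos (by push_cast; omega), Int.toNat_natCast, Nat.add_sub_cancel,
    add_assoc m j j, pow_add, (Even.add_self j).neg_one_pow, mul_one, ← add_assoc]

lemma jacCoeff_of_lt {n : ℤ} {j : ℕ} (s : ℝ) (h : n < j) : jacCoeff s n j = 0 :=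
  if_neg (by omega)

lemma jacCoeff_succ (s : ℝ) (n : ℤ) (j : ℕ) :
    jacCoeff s n (j + 1) = (j - n) * (n + j + s) * jacCoeff s n j := by
  rcases lt_or_ge n j with h | h
  · rw [jacCoeff_of_lt s h, jacCoeff_of_lt s (by push_cast; omega), mul_zero]
  obtain ⟨m, rfl⟩ : ∃ m : ℕ, n = ((m + j : ℕ) : ℤ) := ⟨(n - j).toNat, by push_cast; omega⟩
  rcases m with _ | m
  · rw [jacCoeff_of_lt s (by push_cast; omega)]; simp
  · rw [jacCoeff_natCast_add, show m + 1 + j = m + (j + 1) by ring, jacCoeff_natCast_add,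
      show m + (j + 1) + (j + 1) = m + (j + 1) + j + 1 by ring, poch_succ, Nat.factorial_succ]
    have := Nat.factorial_ne_zero m
    push_cast
    field_simp
    ring

/-- With `jacCoeff_shift'`, the contiguity relations on the level of coefficients. -/
lemma jacCoeff_shift (s : ℝ) (n : ℤ) (j : ℕ) :
    (s - 1) * jacCoeff s n j = (j + n + s - 1) * jacCoeff (s - 1) n j := by
  rcases lt_or_ge n j with h | h
  · rw [jacCoeff_of_lt _ h, jacCoeff_of_lt _ h, mul_zero, mul_zero]
  obtain ⟨m, rfl⟩ : ∃ m : ℕ, n = ((m + j : ℕ) : ℤ) := ⟨(n - j).toNat, by push_cast; omega⟩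
  have h1 := poch_succ (s - 1) (m + j + j)
  rw [poch_succ_left, sub_add_cancel] at h1
  rw [jacCoeff_natCast_add, jacCoeff_natCast_add]
  push_cast at h1 ⊢
  linear_combination (-1) ^ m / (m.factorial : ℝ) * h1

lemma jacCoeff_shift' (s : ℝ) (n : ℤ) (j : ℕ) :
    (s - 1) * jacCoeff s (n - 1) j = (j - n) * jacCoeff (s - 1) n j := by
  rcases lt_or_ge n j with h | h
  · rw [jacCoeff_of_lt _ h, jacCoeff_of_lt _ (by omega), mul_zero, mul_zero]
  obtain ⟨m, rfl⟩ : ∃ m : ℕ, n = ((m + j : ℕ) : ℤ) := ⟨(n - j).toNat, by push_cast; omega⟩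
  rcases m with _ | m
  · rw [jacCoeff_of_lt s (by push_cast; omega)]; simp
  · rw [show (((m + 1 + j : ℕ) : ℤ) - 1) = ((m + j : ℕ) : ℤ) by push_cast; ring,
      jacCoeff_natCast_add, jacCoeff_natCast_add, show m + 1 + j + j = m + j + j + 1 by ring,
      poch_succ_left, sub_add_cancel, Nat.factorial_succ]
    have := Nat.factorial_ne_zero m
    push_cast
    field_simp
    ring

/-- The expansion of the signed Jacobi polynomial in powers of `1 - t`. The upper limit of the sum
may be any sufficiently large number. -/
lemma signedJacobi_eq_sum (α β : ℝ) (n : ℤ) {N : ℕ} (hN : n < N) : signedJacobi α β n =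
    ∑ j ∈ Finset.range N, (jacCoeff (α + β + 1) n j / (poch (α + 1) j * (j.factorial : ℝ))) •
      (1 - Polynomial.X : ℝ[X]) ^ j := by
  rcases lt_or_ge n 0 with h | h
  · rw [signedJacobi, jacobi, if_pos h, smul_zero, Finset.sum_eq_zero]
    intro j _
    rw [jacCoeff_of_lt _ (by omega), zero_div, zero_smul]
  lift n to ℕ using h
  rw [signedJacobi, jacobi, if_neg (by omega), Int.toNat_natCast, jacobiNat,
    ← Finset.sum_subset (Finset.range_subset_range.mpr (by omega : n + 1 ≤ N)) fun j _ hj => by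
      rw [jacCoeff_of_lt _ (by simp at hj; omega), zero_div, zero_smul],
    Finset.mul_sum, Finset.smul_sum]
  refine Finset.sum_congr rfl fun j hj => ?_
  have hjn : j ≤ n := by simpa [Nat.lt_succ_iff] using hj
  rw [← mul_assoc, ← Polynomial.C_mul, ← Polynomial.smul_eq_C_mul, smul_smul]
  congr 1
  rw [jacCoeff, if_pos (by omega), Int.toNat_natCast, poch_add]
  have h1 := poch_neg n j hjn
  have h2 : (n.factorial : ℝ) ≠ 0 := by exact_mod_cast n.factorial_ne_zero
  have h3 : ((n - j).factorial : ℝ) ≠ 0 := by exact_mod_cast (n - j).factorial_ne_zero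
  have h4 : poch (-(n : ℝ)) j = (-1) ^ j * (n.factorial : ℝ) / ((n - j).factorial : ℝ) := by
    rw [eq_div_iff h3, h1]
  have h5 : α + β + 1 + (n : ℝ) = n + α + β + 1 := by ring
  rw [h4, h5, zpow_natCast, pow_add]
  field_simp

lemma D1_signedJacobi (α β : ℝ) (n : ℤ) {N : ℕ} (hN : n < N) : D1 (signedJacobi α β n) =
    ∑ j ∈ Finset.range N, ((j : ℝ) * (jacCoeff (α + β + 1) n j /
      (poch (α + 1) j * (j.factorial : ℝ)))) • (1 - Polynomial.X : ℝ[X]) ^ j := by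
  rw [signedJacobi_eq_sum α β n hN, map_sum]
  refine Finset.sum_congr rfl fun j _ => ?_
  rw [map_smul, D1_pow, smul_smul, mul_comm]

lemma poch_add_one_ne_zero {α : ℝ} (hα : -1 < α) (j : ℕ) : poch (α + 1) j ≠ 0 :=
  poch_ne_zero fun i _ => by
    have : (0 : ℝ) ≤ i := i.cast_nonneg
    linarith

lemma D2_signedJacobi {α : ℝ} (hα : -1 < α) (β : ℝ) (n : ℤ) {N : ℕ} (hN : n < N) :
    D2 α (signedJacobi α β n) = ∑ j ∈ Finset.range N,
      ((j - n) * (n + j + (α + β + 1)) * (jacCoeff (α + β + 1) n j /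
        (poch (α + 1) j * (j.factorial : ℝ)))) • (1 - Polynomial.X : ℝ[X]) ^ j := by
  rw [signedJacobi_eq_sum α β n (N := N + 1) (by push_cast; omega), map_sum,
    Finset.sum_range_succ', map_smul, D2_pow, Nat.cast_zero, zero_mul, zero_smul, smul_zero,
    add_zero]
  refine Finset.sum_congr rfl fun j _ => ?_
  rw [map_smul, D2_pow, smul_smul, Nat.add_sub_cancel]
  congr 1
  have h1 := poch_add_one_ne_zero hα j
  have h2 : ((j.factorial : ℕ) : ℝ) ≠ 0 := by exact_mod_cast j.factorial_ne_zero
  have h3 : (0 : ℝ) ≤ j := j.cast_nonneg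
  have h4 : α + 1 + (j : ℝ) ≠ 0 := by linarith
  rw [jacCoeff_succ, poch_succ, Nat.factorial_succ]
  push_cast
  field_simp
  ring

lemma jacobiOp_signedJacobi {α : ℝ} (hα : -1 < α) (β : ℝ) (n : ℤ) :
    jacobiOp α (α + β + 1) (signedJacobi α β n) =
      lam (α + β + 1) n • signedJacobi α β n := by
  obtain ⟨N, hN⟩ : ∃ N : ℕ, n < N := ⟨n.toNat + 1, by push_cast; omega⟩
  rw [jacobiOp, LinearMap.sub_apply, LinearMap.sub_apply, pow_two, Module.End.mul_apply,
    LinearMap.smul_apply, D2_signedJacobi hα β n hN, D1_signedJacobi α β n hN,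
    signedJacobi_eq_sum α β n hN, map_sum, Finset.smul_sum, Finset.smul_sum,
    ← Finset.sum_sub_distrib, ← Finset.sum_sub_distrib]
  refine Finset.sum_congr rfl fun j _ => ?_
  rw [map_smul, D1_pow, smul_smul, smul_smul, smul_smul, ← sub_smul, ← sub_smul, lam]
  congr 1
  ring

/-- Contiguity: lowering `β` by one turns the shift `n ↦ n - 1` into first-order operators in
`𝒟₁`; see `signedJacobi_pred` for the shifted term. -/
lemma signedJacobi_self (α β : ℝ) (n : ℤ) : (α + β) • signedJacobi α β n =
    D1 (signedJacobi α (β - 1) n) + (n + α + β : ℝ) • signedJacobi α (β - 1) n := by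
  obtain ⟨N, hN⟩ : ∃ N : ℕ, n < N := ⟨n.toNat + 1, by push_cast; omega⟩
  rw [D1_signedJacobi α (β - 1) n hN, signedJacobi_eq_sum α β n hN,
    signedJacobi_eq_sum α (β - 1) n hN, Finset.smul_sum, Finset.smul_sum, ← Finset.sum_add_distrib]
  refine Finset.sum_congr rfl fun j _ => ?_
  have h := jacCoeff_shift (α + β + 1) n j
  rw [show α + β + 1 - 1 = α + (β - 1) + 1 by ring] at h
  rw [smul_smul, smul_smul, ← add_smul]
  congr 1
  linear_combination h / (poch (α + 1) j * (j.factorial : ℝ))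

lemma signedJacobi_pred (α β : ℝ) (n : ℤ) : (α + β) • signedJacobi α β (n - 1) =
    D1 (signedJacobi α (β - 1) n) - (n : ℝ) • signedJacobi α (β - 1) n := by
  obtain ⟨N, hN⟩ : ∃ N : ℕ, n < N := ⟨n.toNat + 1, by push_cast; omega⟩
  rw [D1_signedJacobi α (β - 1) n hN, signedJacobi_eq_sum α β (n - 1) (by omega : n - 1 < N),
    signedJacobi_eq_sum α (β - 1) n hN, Finset.smul_sum, Finset.smul_sum, ← Finset.sum_sub_distrib]
  refine Finset.sum_congr rfl fun j _ => ?_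
  have h := jacCoeff_shift' (α + β + 1) n j
  rw [show α + β + 1 - 1 = α + (β - 1) + 1 by ring] at h
  rw [smul_smul, smul_smul, ← sub_smul]
  congr 1
  linear_combination h / (poch (α + 1) j * (j.factorial : ℝ))

/-- `𝒟₁` inverts a backward difference in `n`. -/
lemma D1_signedJacobi_sub {α β : ℝ} (h : α + β ≠ 0) (n : ℤ) :
    D1 (signedJacobi α β n) - D1 (signedJacobi α β (n - 1)) =
      (n : ℝ) • signedJacobi α β n + (n + α + β : ℝ) • signedJacobi α β (n - 1) := by
  refine smul_right_injective _ h ?_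
  have h1 := signedJacobi_self α β n
  have h2 := signedJacobi_pred α β n
  simp only [smul_sub, smul_add, ← map_smul, smul_comm (α + β), h1, h2]
  simp only [map_add, map_sub, map_smul]
  module

/-- If no `p_n^{α,β}` degenerates, then linear maps on `ℝ[t]` are determined by their values on
the Jacobi polynomials. -/
lemma end_ext_signedJacobi {V : Type*} [AddCommGroup V] [Module ℝ V] {α β : ℝ} (hα : -1 < α)
    (hs : ∀ i : ℕ, α + β + 1 + i ≠ 0) {S T : ℝ[X] →ₗ[ℝ] V}
    (h : ∀ n : ℕ, S (signedJacobi α β n) = T (signedJacobi α β n)) : S = T := by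
  refine end_ext_pow fun n => ?_
  induction n using Nat.strong_induction_on with
  | _ n ih =>
    have h1 := h n
    rw [signedJacobi_eq_sum α β n (by omega : (n : ℤ) < ((n + 1 : ℕ) : ℤ)), map_sum, map_sum,
      Finset.sum_range_succ, Finset.sum_range_succ] at h1
    simp only [map_smul] at h1
    rw [Finset.sum_congr rfl fun j hj => by rw [ih j (Finset.mem_range.mp hj)]] at h1
    refine smul_right_injective _ ?_ (add_left_cancel h1)
    have h2 := jacCoeff_natCast_add (α + β + 1) 0 n
    rw [zero_add] at h2
    rw [h2]
    have h3 : poch (α + β + 1) (n + n) ≠ 0 := poch_ne_zero fun i _ => hs i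
    have h4 := poch_add_one_ne_zero hα n
    have h5 : ((n.factorial : ℕ) : ℝ) ≠ 0 := by exact_mod_cast n.factorial_ne_zero
    simp [h3, h4, h5]

/-! ### Polynomial functions with a reflection symmetry -/

/-- The algebra of polynomial functions on `ℝ`. -/
noncomputable def polyFun : Subalgebra ℝ (ℝ → ℝ) := (Polynomial.aeval (id : ℝ → ℝ)).range

lemma mem_polyFun {F : ℝ → ℝ} : F ∈ polyFun ↔ ∃ P : ℝ[X], ∀ x, F x = P.eval x := by
  have h : ∀ (P : ℝ[X]) (x : ℝ), Polynomial.aeval (id : ℝ → ℝ) P x = P.eval x := by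
    intro P x
    exact (Polynomial.aeval_algHom_apply (Pi.evalAlgHom ℝ (fun _ : ℝ => ℝ) x) id P).symm
  constructor
  · rintro ⟨P, rfl⟩
    exact ⟨P, h P⟩
  · rintro ⟨P, hP⟩
    exact ⟨P, funext fun x => (h P x).trans (hP x).symm⟩

lemma id_mem_polyFun : (fun x : ℝ => x) ∈ polyFun := mem_polyFun.mpr ⟨Polynomial.X, by simp⟩

lemma const_mem_polyFun (c : ℝ) : (fun _ : ℝ => c) ∈ polyFun :=
  mem_polyFun.mpr ⟨Polynomial.C c, by simp⟩

lemma comp_mem_polyFun {F G : ℝ → ℝ} (hF : F ∈ polyFun) (hG : G ∈ polyFun) :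
    (fun x => F (G x)) ∈ polyFun := by
  obtain ⟨P, hP⟩ := mem_polyFun.mp hF
  obtain ⟨Q, hQ⟩ := mem_polyFun.mp hG
  exact mem_polyFun.mpr ⟨P.comp Q, by simp [hP, hQ]⟩

lemma eval_mem_polyFun (P : ℝ[X]) {G : ℝ → ℝ} (hG : G ∈ polyFun) :
    (fun x => P.eval (G x)) ∈ polyFun :=
  comp_mem_polyFun (F := fun x => P.eval x) (mem_polyFun.mpr ⟨P, fun _ => rfl⟩) hG

lemma add_const_mem_polyFun (c : ℝ) : (fun x : ℝ => x + c) ∈ polyFun :=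
  add_mem id_mem_polyFun (const_mem_polyFun c)

lemma sub_const_mem_polyFun (c : ℝ) : (fun x : ℝ => x - c) ∈ polyFun :=
  sub_mem id_mem_polyFun (const_mem_polyFun c)

lemma const_sub_mem_polyFun (c : ℝ) : (fun x : ℝ => c - x) ∈ polyFun :=
  sub_mem (const_mem_polyFun c) id_mem_polyFun

lemma lam_mem_polyFun (ξ : ℝ) : lam ξ ∈ polyFun :=
  mem_polyFun.mpr ⟨-Polynomial.X * (Polynomial.X + Polynomial.C ξ), by simp [lam]⟩

lemma det_mem_polyFun {n : ℕ} {M : ℝ → Matrix (Fin n) (Fin n) ℝ}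
    (h : ∀ i j, (fun x => M x i j) ∈ polyFun) : (fun x => (M x).det) ∈ polyFun := by
  have : (fun x => (M x).det) = ∑ σ : Equiv.Perm (Fin n), ((Equiv.Perm.sign σ : ℤ) : ℝ) •
      ∏ i, fun x => M x (σ i) i := by
    ext x
    simp [Matrix.det_apply, Finset.sum_apply, Finset.prod_apply, Units.smul_def]
  rw [this]
  exact sum_mem fun σ _ => Subalgebra.smul_mem _ (prod_mem fun i _ => h _ _) _

lemma eq_zero_of_mem_polyFun {F : ℝ → ℝ} (hF : F ∈ polyFun) (h : ∀ n : ℤ, F n = 0) : F = 0 := by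
  obtain ⟨P, hP⟩ := mem_polyFun.mp hF
  have : P = 0 := by
    refine Polynomial.eq_zero_of_infinite_isRoot P
      ((Set.infinite_range_of_injective (Int.cast_injective (α := ℝ))).mono ?_)
    rintro _ ⟨n, rfl⟩
    exact (hP n).symm.trans (h n)
  exact funext fun x => by rw [hP x, this]; simp

lemma eq_zero_of_mul_eq_zero_of_mem_polyFun {F G : ℝ → ℝ} (hF : F ∈ polyFun) (hG : G ∈ polyFun)
    (hG0 : ∃ x, G x ≠ 0) (h : ∀ x, F x * G x = 0) : F = 0 := by
  obtain ⟨P, hP⟩ := mem_polyFun.mp hF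
  obtain ⟨Q, hQ⟩ := mem_polyFun.mp hG
  obtain ⟨x, hx⟩ := hG0
  have hPQ : P * Q = 0 := Polynomial.funext fun x => by simp [← hP, ← hQ, h]
  rcases mul_eq_zero.mp hPQ with h0 | h0
  · exact funext fun x => by rw [hP x, h0]; simp
  · exact absurd (by rw [hQ, h0]; simp) hx

lemma exists_eval_sq_of_even {P : ℝ[X]} (h : ∀ x, P.eval (-x) = P.eval x) :
    ∃ Q : ℝ[X], ∀ x, P.eval x = Q.eval (x ^ 2) := by
  have h1 : P.comp (Polynomial.C (-1) * Polynomial.X) = P := Polynomial.funext fun x => by simp [h]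
  have h2 : Polynomial.expand ℝ 2 (Polynomial.contract 2 P) = P := by
    ext n
    rw [Polynomial.coeff_expand two_pos, Polynomial.coeff_contract two_ne_zero]
    split_ifs with hn
    · rw [Nat.div_mul_cancel hn]
    · have h3 : (P.comp (Polynomial.C (-1) * Polynomial.X)).coeff n = -P.coeff n := by
        rw [Polynomial.comp_C_mul_X_coeff, (Nat.not_even_iff_odd.mp
          (mt Even.two_dvd hn)).neg_one_pow, mul_neg_one]
      rw [h1] at h3
      linarith
  exact ⟨Polynomial.contract 2 P, fun x => by
    conv_lhs => rw [← h2]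
    rw [Polynomial.expand_eval]⟩

/-- A polynomial that is invariant under `x ↦ -ξ - x` is a polynomial in `λ_x^ξ`. -/
lemma exists_eval_lam_of_symm {F : ℝ → ℝ} (hF : F ∈ polyFun) (ξ : ℝ)
    (h : ∀ x, F (-ξ - x) = F x) : ∃ Q : ℝ[X], ∀ x, F x = Q.eval (lam ξ x) := by
  obtain ⟨P, hP⟩ := mem_polyFun.mp (comp_mem_polyFun hF (sub_const_mem_polyFun (ξ / 2)))
  obtain ⟨Q, hQ⟩ := exists_eval_sq_of_even (P := P) fun x => by
    rw [← hP, ← hP, ← h]; congr 1; ring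
  refine ⟨Q.comp (Polynomial.C (ξ ^ 2 / 4) - Polynomial.X), fun x => ?_⟩
  have h1 := hP (x + ξ / 2)
  rw [add_sub_cancel_right, hQ] at h1
  rw [h1, Polynomial.eval_comp]
  congr 1
  simp [lam]
  ring

/-- A polynomial that changes sign under `x ↦ -ξ - x` is divisible by `2x + ξ`. -/
lemma exists_eval_lam_of_antisymm {F : ℝ → ℝ} (hF : F ∈ polyFun) (ξ : ℝ)
    (h : ∀ x, F (-ξ - x) = -F x) :
    ∃ Q : ℝ[X], ∀ x, F x = (2 * x + ξ) * Q.eval (lam ξ x) := by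
  obtain ⟨P, hP⟩ := mem_polyFun.mp hF
  have h0 : P.eval (-ξ / 2) = 0 := by
    have := h (-ξ / 2)
    rw [show -ξ - -ξ / 2 = -ξ / 2 by ring, hP] at this
    linarith
  obtain ⟨R, hR⟩ := Polynomial.dvd_iff_isRoot.mpr h0
  have hR' : ∀ x, F x = (2 * x + ξ) * (R.eval x / 2) := fun x => by
    rw [hP, hR]; simp; ring
  have hRmem : (fun x => R.eval x / 2) ∈ polyFun :=
    mem_polyFun.mpr ⟨Polynomial.C (1 / 2) * R, fun x => by simp; ring⟩
  have h2 := eq_zero_of_mul_eq_zero_of_mem_polyFun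
    (F := fun x => R.eval (-ξ - x) / 2 - R.eval x / 2)
    (G := fun x => 2 * x + ξ)
    (sub_mem (comp_mem_polyFun hRmem (const_sub_mem_polyFun (-ξ))) hRmem)
    (mem_polyFun.mpr ⟨2 * Polynomial.X + Polynomial.C ξ, by simp⟩)
    ⟨1 - ξ / 2, by ring_nf; norm_num⟩ fun x => by
      have := h x
      rw [hR', hR' x] at this
      linear_combination -this
  obtain ⟨Q, hQ⟩ := exists_eval_lam_of_symm hRmem ξ fun x => sub_eq_zero.mp (congrFun h2 x)
  exact ⟨Q, fun x => by rw [hR', hQ]⟩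

/-! ### Discrete Wronskians and their cofactors -/

lemma sign_revPerm (n : ℕ) : Equiv.Perm.sign (Fin.revPerm : Equiv.Perm (Fin n)) =
    (-1) ^ (∑ i ∈ Finset.range n, i) := by
  rw [Equiv.Perm.sign_eq_prod_prod_Iio, ← Finset.prod_pow_eq_pow_sum,
    ← Fin.prod_univ_eq_prod_range (fun i => (-1 : ℤˣ) ^ i)]
  refine Finset.prod_congr rfl fun j _ => ?_
  rw [Finset.prod_congr rfl (g := fun _ => (-1 : ℤˣ)) fun i hi => ?_]
  · simp
  · have hij := Finset.mem_Iio.mp hi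
    simp [hij.le]

/-- The sign of the reversal of `n` columns. -/
noncomputable def revSign (n : ℕ) : ℝ :=
  ((Equiv.Perm.sign (Fin.revPerm : Equiv.Perm (Fin n)) : ℤ) : ℝ)

lemma revSign_mul_self (n : ℕ) : revSign n * revSign n = 1 := by
  rw [revSign, ← Int.cast_mul, ← Units.val_mul, Int.units_mul_self]; simp

lemma revSign_succ (k : ℕ) : revSign (k + 1) = if k % 4 = 0 ∨ k % 4 = 3 then 1 else -1 := by
  have h : ∀ k : ℕ, revSign (k + 1) = (-1) ^ (k * (k + 1) / 2) := fun k => by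
    rw [revSign, sign_revPerm, Finset.sum_range_id, mul_comm]; simp
  rw [h]
  have hk := Nat.div_add_mod k 4
  generalize k / 4 = q at hk
  have h4 : k % 4 < 4 := Nat.mod_lt _ (by norm_num)
  generalize k % 4 = r at hk h4
  subst hk
  have h5 : (4 * q + r) * (4 * q + r + 1) / 2 =
      2 * (q * (4 * q + 2 * r + 1)) + r * (r + 1) / 2 := by
    rw [show (4 * q + r) * (4 * q + r + 1) =
      2 * (2 * (q * (4 * q + 2 * r + 1))) + r * (r + 1) by ring]
    omega
  rw [h5, pow_add, pow_mul]
  interval_cases r <;> norm_num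

section Wronskian

variable {k : ℕ}

/-- The cofactors of the last row in `det (G_0(x - j); …; G_{k-1}(x - j); v_j)`. -/
noncomputable def cofac (G : Fin k → ℝ → ℝ) (x : ℝ) (j : Fin (k + 1)) : ℝ :=
  (-1) ^ (k + (j : ℕ)) * Matrix.det (Matrix.of fun i l : Fin k => G i (x - (j.succAbove l : ℕ)))

lemma det_snoc {A : Type*} [CommRing A] [Algebra ℝ A] (G : Fin k → ℝ → ℝ) (x : ℝ)
    (v : Fin (k + 1) → A) :
    Matrix.det (Matrix.of (Fin.snoc (α := fun _ => Fin (k + 1) → A)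
      (fun i j => algebraMap ℝ A (G i (x - (j : ℕ)))) v)) = ∑ j, cofac G x j • v j := by
  rw [Matrix.det_succ_row _ (Fin.last k)]
  refine Finset.sum_congr rfl fun j _ => ?_
  have : (Matrix.of (Fin.snoc (α := fun _ => Fin (k + 1) → A)
      (fun i j => algebraMap ℝ A (G i (x - (j : ℕ)))) v)).submatrix (Fin.last k).succAbove
        j.succAbove = (algebraMap ℝ A).mapMatrix
          (Matrix.of fun i l => G i (x - (j.succAbove l : ℕ))) := by
    ext i l
    simp
  rw [this, ← RingHom.map_det, cofac, Algebra.smul_def, map_mul, map_pow, map_neg, map_one]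
  simp only [Matrix.of_apply, Fin.snoc_last, Fin.val_last]
  ring

lemma sum_cofac_mul (G : Fin k → ℝ → ℝ) (x : ℝ) (i : Fin k) :
    ∑ j, cofac G x j * G i (x - (j : ℕ)) = 0 := by
  have h := det_snoc (A := ℝ) G x fun j => G i (x - (j : ℕ))
  simp only [smul_eq_mul] at h
  rw [← h]
  refine Matrix.det_zero_of_row_eq (Fin.castSucc_lt_last i).ne ?_
  ext j
  simp

lemma cofac_mem_polyFun {G : Fin k → ℝ → ℝ} (hG : ∀ i, G i ∈ polyFun) (j : Fin (k + 1)) :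
    (fun x => cofac G x j) ∈ polyFun :=
  mul_mem (const_mem_polyFun _) (det_mem_polyFun fun i _ =>
    comp_mem_polyFun (hG i) (sub_const_mem_polyFun _))

lemma cofac_reflect {G : Fin k → ℝ → ℝ} {s : ℝ} (hG : ∀ i x, G i (-s - x) = G i x) (x : ℝ)
    (j : Fin (k + 1)) : cofac G (k - s - x) j.rev = revSign (k + 1) * cofac G x j := by
  have h : ∀ x j, cofac G x j = Matrix.det (Matrix.of (Fin.snoc (α := fun _ => Fin (k + 1) → ℝ)
      (fun i j => G i (x - (j : ℕ))) (Pi.single j 1))) := fun x j => by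
    have := det_snoc (A := ℝ) G x (Pi.single j 1)
    simp only [Algebra.algebraMap_self, RingHom.id_apply] at this
    rw [this, Finset.sum_eq_single j (fun l _ hl => by simp [hl]) (by simp)]
    simp
  rw [h, h, revSign, ← Matrix.det_permute']
  congr 1
  ext i l
  induction i using Fin.lastCases with
  | last =>
    have : l = j.rev ↔ l.rev = j := Fin.rev_eq_iff.symm
    simp [Pi.single_apply, this]
  | cast i =>
    simp only [Matrix.of_apply, Matrix.submatrix_apply, Fin.snoc_castSucc, id, Fin.revPerm_apply]
    rw [← hG]
    congr 1
    rw [Fin.val_rev, Nat.cast_sub (by omega)]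
    push_cast
    ring

/-- The extended Jacobi polynomials in terms of the sign-free data: the signs of the columns
factor out of the determinant. -/
lemma qpoly_eq (α β : ℝ) {ψ : Fin k → ℤ → ℝ} {G : Fin k → ℝ → ℝ}
    (hG : ∀ i (n : ℤ), ψ i n = (-1 : ℝ) ^ n * G i n) (n : ℤ) :
    qpoly α β ψ n = (∏ j : Fin (k + 1), (-1 : ℝ) ^ (n - (j : ℕ))) •
      ∑ j : Fin (k + 1), cofac G n j • signedJacobi α β (n - (j : ℕ)) := by
  rw [← det_snoc, Polynomial.smul_eq_C_mul, map_prod, ← Matrix.det_mul_row, qpoly,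
    discreteWronskian]
  congr 1
  ext1 i j
  induction i using Fin.lastCases with
  | last =>
    simp only [Matrix.of_apply, Fin.snoc_last, signedJacobi]
    rw [← Polynomial.smul_eq_C_mul, smul_smul, ← mul_zpow]
    simp
  | cast i =>
    simp only [Matrix.of_apply, Fin.snoc_castSucc, hG]
    rw [Polynomial.algebraMap_eq, ← Polynomial.C_mul]
    push_cast
    rfl

/-! ### The intertwiner -/

lemma D1_mem (α : ℝ) : D1 ∈ algD α := Algebra.subset_adjoin (Or.inl rfl)

lemma jacobiOp_mem (α s : ℝ) : jacobiOp α s ∈ algD α :=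
  sub_mem (sub_mem (Algebra.subset_adjoin (Or.inr rfl)) (pow_mem (D1_mem α) 2))
    (Subalgebra.smul_mem _ (D1_mem α) s)

lemma aeval_mem_algD {α : ℝ} {T : Module.End ℝ ℝ[X]} (hT : T ∈ algD α) (P : ℝ[X]) :
    Polynomial.aeval T P ∈ algD α :=
  Algebra.adjoin_le (Set.singleton_subset_iff.mpr hT) (P.aeval_mem_adjoin_singleton ℝ T)

/-- Up to a constant, the polynomial that expresses `(-1)^(n-j) p_{n-j}^{α,β}` through
`(-1)^n p_n^{α,β-k}` by evaluation at `𝒟₁`, with `s = α + β + 1` and `x = n`. -/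
noncomputable def shiftPoly (k : ℕ) (s : ℝ) (j : ℕ) (x : ℝ) : ℝ[X] :=
  (∏ l ∈ Finset.range j, (Polynomial.X - Polynomial.C (x - l))) *
    ∏ l ∈ Finset.range (k - j), (Polynomial.X + Polynomial.C (x + s - k + l))

lemma signedJacobi_eq_aeval_shiftPoly (α β : ℝ) (k : ℕ) {j : ℕ} (hj : j ≤ k) (n : ℤ) :
    (∏ l ∈ Finset.range k, (α + β - l)) • signedJacobi α β (n - j) =
      Polynomial.aeval D1 (shiftPoly k (α + β + 1) j n) (signedJacobi α (β - k) n) := by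
  induction k generalizing j n with
  | zero =>
    obtain rfl : j = 0 := by omega
    simp [shiftPoly]
  | succ k ih =>
    rw [Finset.prod_range_succ, mul_comm, mul_smul]
    rcases Nat.lt_or_ge k j with h | h
    · obtain rfl : j = k + 1 := by omega
      have h1 := signedJacobi_pred α (β - k) n
      rw [sub_sub] at h1
      rw [show n - ((k + 1 : ℕ) : ℤ) = (n - 1) - (k : ℕ) by push_cast; ring, ih le_rfl, ← map_smul,
        show α + β - k = α + (β - k) by ring, h1, shiftPoly, shiftPoly, Nat.sub_self, Nat.sub_self,
        Finset.prod_range_succ', Finset.prod_range_zero, Finset.prod_range_zero, mul_one, mul_one,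
        map_mul, Module.End.mul_apply]
      congr 2
      · congr 2
        ext1 l
        push_cast
        ring_nf
      · simp only [Polynomial.aeval_X, Polynomial.aeval_C, map_sub, LinearMap.sub_apply,
          Module.algebraMap_end_apply, Nat.cast_succ, Nat.cast_zero, sub_zero]
    · have h1 := signedJacobi_self α (β - k) n
      rw [sub_sub] at h1
      rw [ih h, ← map_smul, show α + β - k = α + (β - k) by ring, h1, shiftPoly, shiftPoly,
        Nat.succ_sub h, Finset.prod_range_succ', ← mul_assoc, map_mul (Polynomial.aeval D1) (_ * _),
        Module.End.mul_apply]
      congr 2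
      · congr 3
        ext1 l
        push_cast
        ring_nf
      · have h2 : (n : ℝ) + (α + β + 1) - ((k + 1 : ℕ) : ℝ) + ((0 : ℕ) : ℝ) = n + α + (β - k) := by
          push_cast; ring
        rw [h2, map_add, Polynomial.aeval_X, Polynomial.aeval_C, LinearMap.add_apply,
          Module.algebraMap_end_apply, Nat.cast_succ]

lemma shiftPoly_reflect (s : ℝ) {j : ℕ} (hj : j ≤ k) (x : ℝ) :
    shiftPoly k s (k - j) (k - s - x) = shiftPoly k s j x := by
  rw [shiftPoly, shiftPoly, mul_comm, Nat.sub_sub_self hj]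
  congr 1 <;> refine Finset.prod_congr rfl fun l _ => ?_
  · rw [sub_eq_add_neg Polynomial.X, ← Polynomial.C_neg]
    congr 2
    ring
  · rw [sub_eq_add_neg Polynomial.X, ← Polynomial.C_neg]
    congr 2
    ring

lemma natDegree_shiftPoly_lt (s : ℝ) {j : ℕ} (hj : j ≤ k) (x : ℝ) :
    (shiftPoly k s j x).natDegree < k + 1 := by
  have h1 : (∏ l ∈ Finset.range j, (Polynomial.X - Polynomial.C (x - l))).natDegree ≤ j :=
    (Polynomial.natDegree_prod_le _ _).trans (by simp [-map_sub])
  have h2 : (∏ l ∈ Finset.range (k - j),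
      (Polynomial.X + Polynomial.C (x + s - k + l))).natDegree ≤ k - j :=
    (Polynomial.natDegree_prod_le _ _).trans (by simp [-map_add])
  have h3 := Polynomial.natDegree_mul_le_of_le h1 h2
  rw [shiftPoly]
  omega

lemma coeff_mul_mem_polyFun {Φ Ψ : ℝ → ℝ[X]} (hΦ : ∀ i, (fun x => (Φ x).coeff i) ∈ polyFun)
    (hΨ : ∀ i, (fun x => (Ψ x).coeff i) ∈ polyFun) (i : ℕ) :
    (fun x => (Φ x * Ψ x).coeff i) ∈ polyFun := by
  simp only [Polynomial.coeff_mul]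
  have : (fun x => ∑ p ∈ Finset.HasAntidiagonal.antidiagonal i, (Φ x).coeff p.1 * (Ψ x).coeff p.2) =
      ∑ p ∈ Finset.HasAntidiagonal.antidiagonal i, (fun x => (Φ x).coeff p.1) *
        fun x => (Ψ x).coeff p.2 := by
    ext x; simp
  rw [this]
  exact sum_mem fun p _ => mul_mem (hΦ _) (hΨ _)

lemma coeff_prod_mem_polyFun {ι : Type*} (t : Finset ι) {Φ : ι → ℝ → ℝ[X]}
    (hΦ : ∀ l i, (fun x => (Φ l x).coeff i) ∈ polyFun) (i : ℕ) :
    (fun x => (∏ l ∈ t, Φ l x).coeff i) ∈ polyFun := by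
  classical
  induction t using Finset.induction_on generalizing i with
  | empty => simpa using const_mem_polyFun _
  | insert a t ha ih =>
    simp only [Finset.prod_insert ha]
    exact coeff_mul_mem_polyFun (hΦ a) ih i

lemma coeff_X_add_C_mem_polyFun {F : ℝ → ℝ} (hF : F ∈ polyFun) (i : ℕ) :
    (fun x => (Polynomial.X + Polynomial.C (F x)).coeff i) ∈ polyFun := by
  simp only [Polynomial.coeff_add, Polynomial.coeff_C]
  refine add_mem (const_mem_polyFun _) ?_
  split_ifs
  · exact hF
  · exact const_mem_polyFun 0

lemma coeff_shiftPoly_mem_polyFun (s : ℝ) (j i : ℕ) :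
    (fun x => (shiftPoly k s j x).coeff i) ∈ polyFun := by
  refine coeff_mul_mem_polyFun (coeff_prod_mem_polyFun _ fun l i => ?_)
    (coeff_prod_mem_polyFun _ fun l i => ?_) i
  · simp only [sub_eq_add_neg Polynomial.X, ← Polynomial.C_neg]
    exact coeff_X_add_C_mem_polyFun (neg_mem (sub_const_mem_polyFun _)) i
  · exact coeff_X_add_C_mem_polyFun (add_mem (sub_mem (add_const_mem_polyFun s)
      (const_mem_polyFun _)) (const_mem_polyFun _)) i

/-- The coefficient of `𝒟₁ ^ i` when the extended Jacobi polynomial is written as a polynomial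
in `𝒟₁` applied to `p_n^{α,β-k}`, as a function of `x = n`. -/
noncomputable def interCoeff (G : Fin k → ℝ → ℝ) (s : ℝ) (i : ℕ) (x : ℝ) : ℝ :=
  ∑ j : Fin (k + 1), cofac G x j * (shiftPoly k s j x).coeff i

lemma interCoeff_mem_polyFun {G : Fin k → ℝ → ℝ} (hG : ∀ i, G i ∈ polyFun) (s : ℝ) (i : ℕ) :
    interCoeff G s i ∈ polyFun := by
  have : interCoeff G s i = ∑ j : Fin (k + 1), (fun x => cofac G x j) *
      fun x => (shiftPoly k s j x).coeff i := by
    ext x; simp [interCoeff]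
  rw [this]
  exact sum_mem fun j _ => mul_mem (cofac_mem_polyFun hG j) (coeff_shiftPoly_mem_polyFun s j i)

/-- The reflection `x ↦ k - s - x` reverses the `k + 1` columns. -/
lemma interCoeff_reflect {G : Fin k → ℝ → ℝ} {s : ℝ} (hG : ∀ i x, G i (-s - x) = G i x) (i : ℕ)
    (x : ℝ) : interCoeff G s i (k - s - x) = revSign (k + 1) * interCoeff G s i x := by
  rw [interCoeff, ← Equiv.sum_comp Fin.revPerm, interCoeff, Finset.mul_sum]
  refine Finset.sum_congr rfl fun j _ => ?_
  rw [Fin.revPerm_apply, cofac_reflect hG, Fin.val_rev, Nat.add_sub_add_right,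
    shiftPoly_reflect s (by omega), mul_assoc]

lemma sum_cofac_smul_signedJacobi (α β : ℝ) (G : Fin k → ℝ → ℝ) (n : ℤ) :
    (∏ l ∈ Finset.range k, (α + β - l)) •
      ∑ j : Fin (k + 1), cofac G n j • signedJacobi α β (n - (j : ℕ)) =
      ∑ i ∈ Finset.range (k + 1), interCoeff G (α + β + 1) i n •
        (D1 ^ i) (signedJacobi α (β - k) n) := by
  simp only [Finset.smul_sum, smul_comm _ (cofac _ _ _)]
  rw [Finset.sum_congr rfl fun j _ => by
    rw [signedJacobi_eq_aeval_shiftPoly α β k (by omega : (j : ℕ) ≤ k) n,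
      Polynomial.aeval_eq_sum_range' (natDegree_shiftPoly_lt _ (by omega : (j : ℕ) ≤ k) _),
      LinearMap.sum_apply, Finset.smul_sum]]
  rw [Finset.sum_comm]
  refine Finset.sum_congr rfl fun i _ => ?_
  simp only [LinearMap.smul_apply, smul_smul, interCoeff, Finset.sum_smul]

lemma exists_intertwiner {α β : ℝ} (hα : -1 < α) (hres : ∀ j : ℕ, j ≤ k → α + β + 1 ≠ (j : ℝ))
    {ψ : Fin k → ℤ → ℝ} (hψ : ∀ j, IsSignedPoly (α + β + 1) (ψ j)) :
    ∃ B : algD α, IsIntertwiner α β ψ B := by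
  choose g hg using hψ
  set s := α + β + 1 with hs
  let G : Fin k → ℝ → ℝ := fun i x => (g i).eval (lam s x)
  have hGmem : ∀ i, G i ∈ polyFun := fun i => eval_mem_polyFun (g i) (lam_mem_polyFun s)
  have hGrefl : ∀ i x, G i (-s - x) = G i x := fun i x => by
    simp only [G]; congr 1; simp only [lam]; ring
  have hκ : (∏ l ∈ Finset.range k, (α + β - (l : ℝ))) ≠ 0 := by
    refine Finset.prod_ne_zero_iff.mpr fun l hl h => hres (l + 1) (Finset.mem_range.mp hl) ?_
    push_cast
    linarith
  -- By the reflection symmetry the coefficients are polynomials in the eigenvalue of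
  -- `p_n^{α,β-k}`, up to the factor `2n + s - k` if the `k + 1` columns are reversed by an odd
  -- permutation.
  obtain ⟨Q, hQ⟩ : ∃ Q : ℕ → ℝ[X], ∀ i (n : ℕ), (-1 : ℝ) ^ (n * k) * interCoeff G s i n =
      cfac (α + β) n k * (Q i).eval (lam (α + (β - k) + 1) n) := by
    have hr : ∀ i x, interCoeff G s i (-(α + (β - k) + 1) - x) =
        revSign (k + 1) * interCoeff G s i x := fun i x => by
      rw [← interCoeff_reflect hGrefl]; congr 1; rw [hs]; ring
    by_cases hk : k % 4 = 0 ∨ k % 4 = 3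
    · choose Q hQ using fun i => exists_eval_lam_of_symm (interCoeff_mem_polyFun hGmem s i)
        (α + (β - k) + 1) fun x => by rw [hr, revSign_succ, if_pos hk, one_mul]
      exact ⟨Q, fun i n => by rw [cfac, if_pos hk, hQ]⟩
    · choose Q hQ using fun i => exists_eval_lam_of_antisymm (interCoeff_mem_polyFun hGmem s i)
        (α + (β - k) + 1) fun x => by rw [hr, revSign_succ, if_neg hk, neg_one_mul]
      exact ⟨Q, fun i n => by rw [cfac, if_neg hk, hQ]; ring⟩
  let c : ℝ := (∏ l ∈ Finset.range k, (α + β - (l : ℝ)))⁻¹ *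
    ∏ j : Fin (k + 1), (-1 : ℝ) ^ (-(j : ℤ))
  refine ⟨⟨c • ∑ i ∈ Finset.range (k + 1), D1 ^ i *
    Polynomial.aeval (jacobiOp α (α + (β - k) + 1)) (Q i), Subalgebra.smul_mem _
      (sum_mem fun i _ => mul_mem (pow_mem (D1_mem α) i) (aeval_mem_algD (jacobiOp_mem _ _) _)) c⟩,
    fun n => ?_⟩
  have h1 := sum_cofac_smul_signedJacobi α β G n
  rw [← eq_inv_smul_iff₀ hκ] at h1
  have hsign : (∏ j : Fin (k + 1), (-1 : ℝ) ^ ((n : ℤ) - (j : ℕ))) =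
      (-1) ^ (n * k) * (-1) ^ n * ∏ j : Fin (k + 1), (-1 : ℝ) ^ (-(j : ℤ)) := by
    simp only [sub_eq_add_neg, zpow_add₀ (show (-1 : ℝ) ≠ 0 by norm_num), Finset.prod_mul_distrib]
    simp [pow_succ, pow_mul]
  have hj : jacobi α (β - k) n = (-1 : ℝ) ^ n • signedJacobi α (β - k) n := by
    rw [signedJacobi, smul_smul, zpow_natCast, ← mul_pow]; simp
  rw [qpoly_eq α β (G := G) hg, h1, hsign, hj]
  simp only [LinearMap.smul_apply, LinearMap.sum_apply, Module.End.mul_apply, map_smul,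
    aeval_apply_of_eigen (jacobiOp_signedJacobi hα (β - k) n), Finset.smul_sum, smul_smul]
  refine Finset.sum_congr rfl fun i _ => ?_
  congr 1
  have := hQ i n
  push_cast at this ⊢
  linear_combination (-1) ^ n * c * this

/-! ### The Krall operators -/

/-- The discrete Wronskian of `G_0, …, G_{k-1}` at a real argument. -/
noncomputable def realWronskian (G : Fin k → ℝ → ℝ) (x : ℝ) : ℝ :=
  Matrix.det (Matrix.of fun i j : Fin k => G i (x - (j : ℕ)))

/-- The Wronskian matrix of `G` whose column `c` is the one at the point `x`. -/
noncomputable def window (G : Fin k → ℝ → ℝ) (c : Fin k) (x : ℝ) : Matrix (Fin k) (Fin k) ℝ :=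
  Matrix.of fun i j => G i (x + (c : ℕ) - (j : ℕ))

/-- The linear functional `v ↦ -∑_c H(x + c + 1) det (window with the column at x replaced by v)`.
Its values on the standard basis are the coefficients of the Krall operator. -/
noncomputable def windowForm (H : ℝ → ℝ) (G : Fin k → ℝ → ℝ) (x : ℝ) : (Fin k → ℝ) →ₗ[ℝ] ℝ :=
  -∑ c : Fin k, H (x + (c : ℕ) + 1) • (LinearMap.proj c ∘ₗ Matrix.cramer (window G c x))

lemma windowForm_apply (H : ℝ → ℝ) (G : Fin k → ℝ → ℝ) (x : ℝ) (v : Fin k → ℝ) :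
    windowForm H G x v =
      -∑ c : Fin k, H (x + (c : ℕ) + 1) * Matrix.cramer (window G c x) v c := by
  simp [windowForm]

lemma det_window (G : Fin k → ℝ → ℝ) (c : Fin k) (x : ℝ) :
    (window G c x).det = realWronskian G (x + (c : ℕ)) := rfl

lemma sum_cofac_mul_linear (G : Fin k → ℝ → ℝ) (x : ℝ) (φ : (Fin k → ℝ) →ₗ[ℝ] ℝ) :
    ∑ l, cofac G x l * φ (fun i => G i (x - (l : ℕ))) = 0 := by
  have h : ∑ l, cofac G x l • (fun i => G i (x - (l : ℕ))) = 0 := by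
    ext i
    simpa using sum_cofac_mul G x i
  simpa using congrArg φ h

lemma cramer_window (G : Fin k → ℝ → ℝ) (c j : Fin k) {x y : ℝ} (h : y = x + (c : ℕ) - (j : ℕ)) :
    Matrix.cramer (window G c x) (fun i => G i y) c =
      if j = c then realWronskian G (x + (c : ℕ)) else 0 := by
  rw [Matrix.cramer_row_self (i := j) (h := fun i => by rw [h]; rfl), Pi.single_apply, det_window]
  simp only [eq_comm]

/-- Only the window shifts `c < j` contribute: in the remaining ones the replaced column repeats
another column. -/
lemma sum_Iio_cofac_mul_cramer (G : Fin k → ℝ → ℝ) (x : ℝ) (c : Fin k) (j : Fin (k + 1)) :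
    ∑ l ∈ Finset.Iio j, cofac G (x + (j : ℕ)) l *
      Matrix.cramer (window G c x) (fun i => G i (x + (j : ℕ) - (l : ℕ))) c =
      if (c : ℕ) < j then -(cofac G (x + (j : ℕ)) j * realWronskian G (x + (c : ℕ))) else 0 := by
  have hz : ∀ l : Fin (k + 1), (∃ i : Fin k, i ≠ c ∧ (i : ℕ) + j = c + l) →
      Matrix.cramer (window G c x) (fun i => G i (x + (j : ℕ) - (l : ℕ))) c = 0 := by
    rintro l ⟨i, hi, h⟩
    have h' : ((i : ℕ) : ℝ) + (j : ℕ) = (c : ℕ) + (l : ℕ) := by exact_mod_cast h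
    rw [cramer_window G c i (by linarith), if_neg hi]
  split_ifs with hc
  · have hall := sum_cofac_mul_linear G (x + (j : ℕ))
      (LinearMap.proj c ∘ₗ Matrix.cramer (window G c x))
    simp only [LinearMap.comp_apply, LinearMap.proj_apply] at hall
    have hj : Matrix.cramer (window G c x) (fun i => G i (x + (j : ℕ) - (j : ℕ))) c =
        realWronskian G (x + (c : ℕ)) := by
      rw [cramer_window G c c (by ring), if_pos rfl]
    have hsub : ∑ l ∈ Finset.Iic j, cofac G (x + (j : ℕ)) l *
        Matrix.cramer (window G c x) (fun i => G i (x + (j : ℕ) - (l : ℕ))) c = 0 := by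
      rw [← hall]
      refine Finset.sum_subset (Finset.subset_univ _) fun l _ hl => ?_
      have hl' : (j : ℕ) < l := by simpa using hl
      have h1 := l.2
      rw [hz l ⟨⟨c + l - j, by omega⟩, fun h => ?_, by simp; omega⟩, mul_zero]
      have := congrArg Fin.val h
      simp at this
      omega
    rw [← Finset.Iio_insert, Finset.sum_insert (by simp), hj] at hsub
    linarith
  · refine Finset.sum_eq_zero fun l hl => ?_
    have hl' : (l : ℕ) < j := by simpa using hl
    have h1 := c.2
    rw [hz l ⟨⟨c + l - j, by omega⟩, fun h => ?_, by simp; omega⟩, mul_zero]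
    have := congrArg Fin.val h
    simp at this
    omega

section Band

variable {H f : ℝ → ℝ} {G : Fin k → ℝ → ℝ}
  (hf : ∀ x, f x - f (x - 1) = H x * realWronskian G (x - 1))
include hf

lemma sum_range_telescope (x : ℝ) (m : ℕ) :
    ∑ c ∈ Finset.range m, H (x + c + 1) * realWronskian G (x + c) = f (x + m) - f x := by
  induction m with
  | zero => simp
  | succ m ih =>
    have h := hf (x + m + 1)
    rw [add_sub_cancel_right] at h
    rw [Finset.sum_range_succ, ih, ← h]
    push_cast
    ring_nf

/-- The triangular system that fixes the coefficients of the Krall operator: it accounts for the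
entries of the band between its two ends. -/
lemma sum_Iio_cofac_mul_windowForm (x : ℝ) (j : Fin (k + 1)) :
    ∑ l ∈ Finset.Iio j, cofac G (x + (j : ℕ)) l *
      windowForm H G x (fun i => G i (x + (j : ℕ) - (l : ℕ))) =
      (f (x + (j : ℕ)) - f x) * cofac G (x + (j : ℕ)) j := by
  simp only [windowForm_apply, mul_neg, Finset.mul_sum, Finset.sum_neg_distrib]
  rw [Finset.sum_comm, Finset.sum_congr rfl fun c _ => by
    rw [Finset.sum_congr rfl fun l _ => mul_left_comm _ _ _, ← Finset.mul_sum,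
      sum_Iio_cofac_mul_cramer], ← sum_range_telescope hf]
  rw [Fin.sum_univ_eq_sum_range (fun c => H (x + c + 1) * if c < (j : ℕ) then
    -(cofac G (x + (j : ℕ)) j * realWronskian G (x + c)) else 0) k]
  have hsub : Finset.range (j : ℕ) ⊆ Finset.range k := Finset.range_subset_range.mpr (by omega)
  rw [← Finset.sum_subset hsub fun c _ hc => by
    rw [if_neg (by simpa using hc), mul_zero], ← Finset.sum_neg_distrib, Finset.sum_mul]
  refine Finset.sum_congr rfl fun c hc => ?_
  rw [if_pos (Finset.mem_range.mp hc)]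
  ring

lemma windowForm_self (x : ℝ) : windowForm H G x (fun i => G i x) = f x - f (x + k) := by
  rw [windowForm_apply, ← neg_sub (f (x + k)), ← sum_range_telescope hf,
    ← Fin.sum_univ_eq_sum_range (fun c => H (x + c + 1) * realWronskian G (x + c))]
  congr 1
  refine Finset.sum_congr rfl fun c _ => ?_
  rw [cramer_window G c c (by ring), if_pos rfl]

end Band

lemma realWronskian_reflect {G : Fin k → ℝ → ℝ} {s : ℝ} (hG : ∀ i x, G i (-s - x) = G i x)
    (x : ℝ) : realWronskian G (k - s - x) = revSign k * realWronskian G (x - 1) := by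
  rw [realWronskian, realWronskian, revSign, ← Matrix.det_permute']
  congr 1
  ext i l
  simp only [Matrix.of_apply, Matrix.submatrix_apply, id, Fin.revPerm_apply]
  rw [← hG]
  congr 1
  rw [Fin.val_rev, Nat.cast_sub (by omega)]
  push_cast
  ring

/-- The reflection `x ↦ -s - x` exchanges the windows `c` and `k - 1 - c` and reverses their
columns; the sign this produces cancels against that of `H`. -/
lemma windowForm_single_reflect {H : ℝ → ℝ} {G : Fin k → ℝ → ℝ} {s : ℝ}
    (hG : ∀ i x, G i (-s - x) = G i x) (hH : ∀ x, H (k + 1 - s - x) = -(revSign k * H x))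
    (i : Fin k) (x : ℝ) :
    windowForm H G (-s - x) (Pi.single i 1) = -windowForm H G x (Pi.single i 1) := by
  rw [windowForm_apply, windowForm_apply, ← Equiv.sum_comp Fin.revPerm, ← Finset.sum_neg_distrib,
    neg_neg]
  refine Finset.sum_congr rfl fun c _ => ?_
  have hc : ((c.rev : ℕ) : ℝ) = k - (c + 1 : ℕ) := by
    rw [Fin.val_rev, Nat.cast_sub (by omega)]
  have h1 : H (-s - x + (c.rev : ℕ) + 1) = -(revSign k * H (x + (c : ℕ) + 1)) := by
    rw [← hH, hc]; congr 1; push_cast; ring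
  have h2 : Matrix.cramer (window G c.rev (-s - x)) (Pi.single i 1) c.rev =
      revSign k * Matrix.cramer (window G c x) (Pi.single i 1) c := by
    rw [Matrix.cramer_apply, Matrix.cramer_apply, revSign, ← Matrix.det_permute']
    congr 1
    ext a l
    simp only [Matrix.updateCol_apply, Matrix.submatrix_apply, id, Fin.revPerm_apply,
      Fin.rev_eq_iff, eq_comm (a := l)]
    split_ifs
    · rfl
    · simp only [window, Matrix.of_apply]
      rw [← hG]
      congr 1
      rw [hc, Fin.val_rev, Nat.cast_sub (by omega)]
      push_cast
      ring
  rw [Fin.revPerm_apply, h1, h2]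
  linear_combination (H (x + (c : ℕ) + 1) * Matrix.cramer (window G c x) (Pi.single i 1) c) *
    revSign_mul_self k

lemma windowForm_single_mem_polyFun {H : ℝ → ℝ} {G : Fin k → ℝ → ℝ} (hH : H ∈ polyFun)
    (hG : ∀ i, G i ∈ polyFun) (i : Fin k) :
    (fun x => windowForm H G x (Pi.single i 1)) ∈ polyFun := by
  have : (fun x => windowForm H G x (Pi.single i 1)) = -∑ c : Fin k,
      (fun x => H (x + (c : ℕ) + 1)) *
        fun x => ((window G c x).updateCol c (Pi.single i 1)).det := by
    ext x
    simp [windowForm_apply, Matrix.cramer_apply]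
  rw [this]
  refine neg_mem (sum_mem fun c _ => mul_mem (comp_mem_polyFun hH
    (add_mem (add_const_mem_polyFun _) (const_mem_polyFun 1))) (det_mem_polyFun fun a l => ?_))
  simp only [Matrix.updateCol_apply]
  split_ifs
  · exact const_mem_polyFun _
  · exact comp_mem_polyFun (hG a) (sub_mem (add_const_mem_polyFun _) (const_mem_polyFun _))

/-- Summation by parts for coefficients of total sum zero. -/
lemma sum_smul_eq_sum_Iio_smul {V : Type*} [AddCommGroup V] [Module ℝ V] {T w : ℕ → V}
    (h : ∀ l, T l - T (l + 1) = w (l + 1)) {a : Fin (k + 1) → ℝ} (ha : ∑ l, a l = 0) :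
    ∑ l, a l • T l = ∑ j, (∑ l ∈ Finset.Iio j, a l) • w j := by
  have h1 : ∀ l m : ℕ, l ≤ m → T l = T m + ∑ j ∈ Finset.Ioc l m, w j := by
    intro l m hm
    induction m, hm using Nat.le_induction with
    | base => simp
    | succ m hm ih =>
      rw [Finset.sum_Ioc_succ_top (by omega), ih, ← h m]
      abel
  have h2 : ∀ l : Fin (k + 1), T l = T k + ∑ j ∈ Finset.Ioi l, w j := by
    intro l
    rw [h1 l k (by omega)]
    congr 1
    refine (Finset.sum_nbij (fun j : Fin (k + 1) => (j : ℕ)) ?_ ?_ ?_ ?_).symm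
    · intro j hj
      have : l < j := by simpa using hj
      simp; omega
    · exact Fin.val_injective.injOn
    · intro j hj
      have : (l : ℕ) < j ∧ j ≤ k := by simpa using hj
      exact ⟨⟨j, by omega⟩, by simp [Fin.lt_def, this.1], rfl⟩
    · simp
  rw [Finset.sum_congr rfl fun l _ => by rw [h2 l, smul_add, Finset.smul_sum],
    Finset.sum_add_distrib, ← Finset.sum_smul, ha, zero_smul, zero_add,
    Finset.sum_comm' (s' := fun j => Finset.Iio j) (t' := Finset.univ) (by simp)]
  simp only [Finset.sum_smul]

/-- `𝒟₁ + s/2` maps `h_n` to `(2n + s) h_n / 2` plus the sum of all `(2m + s) h_m` with `m < n`. On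
a combination `∑ a_l h_{n-l}` with `∑ a_l = 0` the terms beyond the band `n - k, …, n` cancel. -/
lemma sum_smul_D1_signedJacobi {α β : ℝ} (h : α + β ≠ 0) (n : ℤ) {a : Fin (k + 1) → ℝ}
    (ha : ∑ l, a l = 0) :
    ∑ l, a l • (D1 + ((α + β + 1) / 2) • 1) (signedJacobi α β (n - (l : ℕ))) =
      ∑ j : Fin (k + 1), ((2 * ((n : ℝ) - (j : ℕ)) + (α + β + 1)) *
        (a j / 2 + ∑ l ∈ Finset.Iio j, a l)) • signedJacobi α β (n - (j : ℕ)) := by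
  have h1 := sum_smul_eq_sum_Iio_smul
    (T := fun l => (D1 + ((α + β + 1) / 2) • 1) (signedJacobi α β (n - (l : ℕ))) -
      ((2 * ((n : ℝ) - l) + (α + β + 1)) / 2) • signedJacobi α β (n - (l : ℕ)))
    (w := fun l => (2 * ((n : ℝ) - l) + (α + β + 1)) • signedJacobi α β (n - (l : ℕ)))
    (fun l => by
      have := D1_signedJacobi_sub h (n - l)
      rw [show n - ((l + 1 : ℕ) : ℤ) = n - l - 1 by push_cast; ring]
      simp only [LinearMap.add_apply, LinearMap.smul_apply, Module.End.one_apply]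
      rw [sub_eq_iff_eq_add.mp this]
      push_cast
      module) ha
  simp only [smul_sub, Finset.sum_sub_distrib, sub_eq_iff_eq_add] at h1
  rw [h1, ← Finset.sum_add_distrib]
  refine Finset.sum_congr rfl fun j _ => ?_
  module

lemma exists_krallOperator {α β : ℝ} (hα : -1 < α) (hαβ : α + β ≠ 0)
    {ψ : Fin k → ℤ → ℝ} (hψ : ∀ j, IsSignedPoly (α + β + 1) (ψ j)) (hτ : ∃ n : ℤ, tau ψ n ≠ 0)
    {F : ℝ[X]} (hF : F ∈ algA α β ψ) : ∃ B : algD α, IsKrallOperator α β ψ F B := by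
  choose g hg using hψ
  obtain ⟨Hp, hHp⟩ := hF
  set s := α + β + 1 with hs
  let G : Fin k → ℝ → ℝ := fun i x => (g i).eval (lam s x)
  let H : ℝ → ℝ := fun x => Hp.eval x
  let f : ℝ → ℝ := fun x => F.eval (lam s (x - k / 2))
  have hGmem : ∀ i, G i ∈ polyFun := fun i => eval_mem_polyFun (g i) (lam_mem_polyFun s)
  have hHmem : H ∈ polyFun := mem_polyFun.mpr ⟨Hp, fun _ => rfl⟩
  have hfmem : f ∈ polyFun :=
    eval_mem_polyFun F (comp_mem_polyFun (lam_mem_polyFun s) (sub_const_mem_polyFun _))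
  have hGrefl : ∀ i x, G i (-s - x) = G i x := fun i x => by
    simp only [G]; congr 1; simp only [lam]; ring
  have hfrefl : ∀ x, f (k - s - x) = f x := fun x => by
    simp only [f]; congr 1; simp only [lam]; ring
  have hτG : ∀ n : ℤ, tau ψ n = realWronskian G n := fun n => by
    rw [tau, discreteWronskian, realWronskian]
    congr 1
    ext i j
    simp only [Matrix.of_apply, hg, G]
    rw [← mul_assoc, ← mul_zpow]
    simp
  have hWmem : (fun x => realWronskian G (x - 1)) ∈ polyFun :=
    det_mem_polyFun fun i j => comp_mem_polyFun (hGmem i)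
      (sub_mem (sub_const_mem_polyFun 1) (const_mem_polyFun _))
  have hf : ∀ x, f x - f (x - 1) = H x * realWronskian G (x - 1) := by
    have := eq_zero_of_mem_polyFun
      (F := fun x => f x - f (x - 1) - H x * realWronskian G (x - 1))
      (sub_mem (sub_mem hfmem (comp_mem_polyFun hfmem (sub_const_mem_polyFun 1)))
        (mul_mem hHmem hWmem)) fun n => by
        have h := hHp n
        rw [hτG, sub_right_comm] at h
        push_cast at h
        exact sub_eq_zero.mpr h
    exact fun x => sub_eq_zero.mp (congrFun this x)
  have hHrefl : ∀ x, H (k + 1 - s - x) = -(revSign k * H x) := by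
    obtain ⟨n, hn⟩ := hτ
    have := eq_zero_of_mul_eq_zero_of_mem_polyFun
      (F := fun x => H (k + 1 - s - x) + revSign k * H x) (G := fun x => realWronskian G (x - 1))
      (add_mem (comp_mem_polyFun hHmem (const_sub_mem_polyFun _))
        (mul_mem (const_mem_polyFun _) hHmem)) hWmem
      ⟨n + 1, by rwa [add_sub_cancel_right, ← hτG]⟩ fun x => by
        have h1 := hf (k + 1 - s - x)
        have h2 := hf x
        rw [show (k : ℝ) + 1 - s - x - 1 = k - s - x by ring, realWronskian_reflect hGrefl,
          hfrefl, show (k : ℝ) + 1 - s - x = k - s - (x - 1) by ring, hfrefl] at h1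
        rw [show (k : ℝ) + 1 - s - x = k - s - (x - 1) by ring]
        linear_combination -revSign k * h1 - revSign k * h2 -
          H (k - s - (x - 1)) * realWronskian G (x - 1) * revSign_mul_self k
    exact fun x => eq_neg_of_add_eq_zero_left (congrFun this x)
  have hfk : (fun x => f (x + k)) ∈ polyFun := comp_mem_polyFun hfmem (add_const_mem_polyFun _)
  -- `P` is the average of `f` over the two ends of the band, and `M i` the coefficients of the
  -- window functional divided by `2x + s`.
  obtain ⟨P, hP⟩ := exists_eval_lam_of_symm (F := fun x => (1 / 2) * (f x + f (x + k)))
    (mul_mem (const_mem_polyFun _) (add_mem hfmem hfk)) s fun x => by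
      rw [← hfrefl (-s - x), ← hfrefl (-s - x + k), show (k : ℝ) - s - (-s - x) = x + k by ring,
        show (k : ℝ) - s - (-s - x + k) = x by ring, add_comm (f x)]
  choose M hM using fun i => exists_eval_lam_of_antisymm
    (windowForm_single_mem_polyFun hHmem hGmem i) s (windowForm_single_reflect hGrefl hHrefl i)
  let J := jacobiOp α s
  have hJ : J ∈ algD α := jacobiOp_mem α s
  refine ⟨⟨Polynomial.aeval J P + ∑ i, Polynomial.aeval J (M i) * (D1 + (s / 2) • 1) *
    Polynomial.aeval J (g i), add_mem (aeval_mem_algD hJ _) (sum_mem fun i _ => mul_mem (mul_mem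
      (aeval_mem_algD hJ _) (add_mem (D1_mem α) (Subalgebra.smul_mem _ (one_mem _) _)))
        (aeval_mem_algD hJ _))⟩, fun n => ?_⟩
  have hev : ∀ (R : ℝ[X]) (j : Fin (k + 1)), Polynomial.aeval J R
      (signedJacobi α β (n - (j : ℕ))) = R.eval (lam s (n - (j : ℕ))) •
        signedJacobi α β (n - (j : ℕ)) := fun R j => by
    have := aeval_apply_of_eigen (jacobiOp_signedJacobi hα β (n - (j : ℕ))) R
    push_cast at this
    exact this
  have hterm : ∀ i, (Polynomial.aeval J (M i) * (D1 + (s / 2) • 1) * Polynomial.aeval J (g i))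
      (∑ j : Fin (k + 1), cofac G n j • signedJacobi α β (n - (j : ℕ))) =
      ∑ j : Fin (k + 1), (windowForm H G (n - (j : ℕ)) (Pi.single i 1) *
        (cofac G n j * G i (n - (j : ℕ)) / 2 +
          ∑ l ∈ Finset.Iio j, cofac G n l * G i (n - (l : ℕ)))) •
            signedJacobi α β (n - (j : ℕ)) := by
    intro i
    have h1 := sum_smul_D1_signedJacobi hαβ n (sum_cofac_mul G n i)
    simp only [Int.cast_natCast] at h1
    rw [Module.End.mul_apply, Module.End.mul_apply, map_sum, map_sum,
      Finset.sum_congr rfl fun j _ => by rw [map_smul, hev, smul_smul, map_smul], h1, map_sum]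
    refine Finset.sum_congr rfl fun j _ => ?_
    rw [map_smul, hev, smul_smul, hM]
    congr 1
    ring
  rw [qpoly_eq α β (G := G) hg, map_smul, smul_comm]
  congr 1
  simp only [Int.cast_natCast]
  rw [LinearMap.add_apply, LinearMap.sum_apply, Finset.sum_congr rfl fun i _ => hterm i,
    Finset.sum_comm, map_sum, ← Finset.sum_add_distrib, Finset.smul_sum]
  refine Finset.sum_congr rfl fun j _ => ?_
  rw [map_smul, hev, smul_smul, ← Finset.sum_smul, ← add_smul, smul_smul, ← hP]
  congr 1
  -- What remains is the scalar identity for the coefficient of each `p_{n-j}`.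
  have hexp : ∀ x (v : Fin k → ℝ), windowForm H G x v =
      ∑ i, windowForm H G x (Pi.single i 1) * v i := fun x v => by
    conv_lhs => rw [LinearMap.pi_apply_eq_sum_univ (windowForm H G x) v]
    refine Finset.sum_congr rfl fun i _ => ?_
    rw [smul_eq_mul, mul_comm]
    congr 2
    ext l
    simp [Pi.single_apply, eq_comm]
  have h1 := sum_Iio_cofac_mul_windowForm hf ((n : ℝ) - (j : ℕ)) j
  have h2 := windowForm_self hf ((n : ℝ) - (j : ℕ))
  rw [sub_add_cancel] at h1
  rw [hexp] at h2
  simp only [hexp _ (fun i => G i (_ - _)), Finset.mul_sum] at h1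
  rw [Finset.sum_comm] at h1
  simp only [mul_add, Finset.sum_add_distrib, Finset.mul_sum]
  rw [Finset.sum_congr rfl fun i _ => Finset.sum_congr rfl fun l _ => mul_left_comm _ _ _, h1,
    Finset.sum_congr rfl fun i _ => show _ = cofac G n j / 2 *
      (windowForm H G (n - (j : ℕ)) (Pi.single i 1) * G i (n - (j : ℕ))) by ring,
    ← Finset.mul_sum, h2]
  ring

end Wronskian

/-! ### The Darboux transformation -/


lemma cfac_ne_zero {s : ℝ} {n k : ℕ} (h : s - k + 1 + (2 * n : ℕ) ≠ 0) : cfac s n k ≠ 0 := by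
  rw [cfac]
  split_ifs
  · simp
  · refine mul_ne_zero (by simp) fun h0 => h ?_
    push_cast
    linarith

/-- The operator identity in one variable: it holds on every `p_n^{α,β-k}`, and these span
`ℝ[t]`. -/
lemma krallOperator_mul_intertwiner {α β : ℝ} (hα : -1 < α) {k : ℕ}
    (hs : ∀ i : ℕ, α + (β - k) + 1 + i ≠ 0) {ψ : Fin k → ℤ → ℝ} {f : ℝ[X]} {Bψ Bf : algD α}
    (hψ : IsIntertwiner α β ψ Bψ) (hf : IsKrallOperator α β ψ f Bf) :
    Bf * Bψ = Bψ * Polynomial.aeval ((⟨jacobiOp α (α + (β - k) + 1), jacobiOp_mem _ _⟩ : algD α) +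
      algebraMap ℝ (algD α) (lam (-(α + β + 1)) (k / 2))) f := by
  refine Subtype.ext (end_ext_signedJacobi hα hs fun n => ?_)
  have hj : signedJacobi α (β - k) n = (-1 : ℝ) ^ n • jacobi α (β - k) n := by
    rw [signedJacobi, zpow_natCast]
  have hc : cfac (α + β) n k ≠ 0 := cfac_ne_zero fun h => hs (2 * n) (by linarith)
  have h1 : (Bψ : Module.End ℝ ℝ[X]) (signedJacobi α (β - k) n) =
      ((-1 : ℝ) ^ n * (cfac (α + β) n k)⁻¹) • qpoly α β ψ n := by
    rw [hψ n, smul_smul, mul_assoc, inv_mul_cancel₀ hc, mul_one, hj, map_smul]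
  have h2 : (jacobiOp α (α + (β - k) + 1) +
      algebraMap ℝ (Module.End ℝ ℝ[X]) (lam (-(α + β + 1)) (k / 2))) (signedJacobi α (β - k) n) =
      lam (α + β + 1) ((n : ℝ) - k / 2) • signedJacobi α (β - k) n := by
    rw [LinearMap.add_apply, jacobiOp_signedJacobi hα, Module.algebraMap_end_apply, ← add_smul]
    congr 1
    simp only [lam, Int.cast_natCast]
    ring
  have h3 : ((Polynomial.aeval ((⟨jacobiOp α (α + (β - k) + 1), jacobiOp_mem _ _⟩ : algD α) +
      algebraMap ℝ (algD α) (lam (-(α + β + 1)) (k / 2))) f : algD α) : Module.End ℝ ℝ[X]) =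
      Polynomial.aeval (jacobiOp α (α + (β - k) + 1) +
        algebraMap ℝ (Module.End ℝ ℝ[X]) (lam (-(α + β + 1)) (k / 2))) f :=
    (Polynomial.aeval_algHom_apply (algD α).val _ f).symm
  rw [Subalgebra.coe_mul, Subalgebra.coe_mul, Module.End.mul_apply, Module.End.mul_apply, h3,
    aeval_apply_of_eigen h2, map_smul, h1, map_smul, hf n, smul_comm]

theorem mainTheorem2 {d : ℕ} [NeZero d] (γ : Fin (d + 1) → ℝ) (hγ : ∀ j, -1 < γ j)
    (α β : ℝ) (hα : α = absTail γ + (d : ℝ) - 1) (hβ : β = γ 0)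
    {k : ℕ} (hk : 0 < k) (hres : ∀ j : ℕ, j ≤ k → α + β + 1 ≠ (j : ℝ))
    (ψ : Fin k → ℤ → ℝ) (hψ : ∀ j, IsSignedPoly (α + β + 1) (ψ j))
    (hτ : ∃ n : ℤ, tau ψ n ≠ 0) :
    (∃ Φ : algD α ≃ₐ[ℝ] algDhat γ, SendsGenerators α γ Φ) ∧
    (∃ Bψ : algD α, IsIntertwiner α β ψ Bψ) ∧
    (∀ f ∈ algA α β ψ, ∃ Bf : algD α, IsKrallOperator α β ψ f Bf) ∧
    ∀ Φ : algD α ≃ₐ[ℝ] algDhat γ, SendsGenerators α γ Φ →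
      ∀ Bψ : algD α, IsIntertwiner α β ψ Bψ →
        ∀ f ∈ algA α β ψ, ∀ Bf : algD α, IsKrallOperator α β ψ f Bf →
          IsDarboux (Φ Bf : Module.End ℝ (MvPolynomial (Fin d) ℝ))
            (Polynomial.aeval
              (appellLauricella (γ - Pi.single 0 (k : ℝ)) +
                algebraMap ℝ (Module.End ℝ (MvPolynomial (Fin d) ℝ))
                  (lam (-absSum γ - (d : ℝ)) ((k : ℝ) / 2))) f)
            (Φ Bψ : Module.End ℝ (MvPolynomial (Fin d) ℝ)) := by

  have hα' : -1 < α := by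
    have h : ∑ _j : Fin d, (-1 : ℝ) < absTail γ :=
      Finset.sum_lt_sum_of_nonempty ⟨0, Finset.mem_univ _⟩ fun j _ => hγ j.succ
    simp at h
    linarith
  have hβ' : -1 < β := hβ ▸ hγ 0
  have hsum : α + β + 1 = absSum γ + d := by
    rw [hα, hβ, absSum, Fin.sum_univ_succ, absTail]
    ring
  have hαβ : α + β ≠ 0 := fun h => hres 1 hk (by rw [h]; simp)
  have hs : ∀ i : ℕ, α + (β - k) + 1 + i ≠ 0 := by
    intro i h
    rcases le_or_gt i k with hi | hi
    · exact hres (k - i) (by omega) (by rw [Nat.cast_sub hi]; linarith)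
    · have : (k : ℝ) + 1 ≤ i := by exact_mod_cast hi
      linarith
  refine ⟨exists_algEquiv hα' hα, exists_intertwiner hα' hres hψ,
    fun f hf => exists_krallOperator hα' hαβ hψ hτ hf, fun Φ hΦ Bψ hBψ f _ Bf hBf => ?_⟩
  -- `Φ` maps the Jacobi operator of `p_n^{α,β-k}` to the Appell–Lauricella operator.
  have hJ : (Φ ⟨jacobiOp α (α + (β - k) + 1), jacobiOp_mem _ _⟩ :
      Module.End ℝ (MvPolynomial (Fin d) ℝ)) = appellLauricella (γ - Pi.single 0 (k : ℝ)) := by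
    have h : (⟨jacobiOp α (α + (β - k) + 1), jacobiOp_mem _ _⟩ : algD α) +
        (absSum γ + (d : ℝ) - k) • genD1 α + genD1 α ^ 2 = genD2 α := by
      rw [← hsum, show α + β + 1 - k = α + (β - k) + 1 by ring]
      refine Subtype.ext ?_
      change D2 α - D1 ^ 2 - _ • D1 + _ • D1 + D1 ^ 2 = D2 α
      abel
    have h' := congrArg (fun x => (Φ x : Module.End ℝ (MvPolynomial (Fin d) ℝ))) h
    simp only [map_add, map_smul, map_pow, Subalgebra.coe_add, Subalgebra.coe_smul,
      Subalgebra.coe_pow, hΦ.1, hΦ.2] at h'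
    rw [appellLauricella_eq_hatD, ← h']
    abel
  have h := congrArg (fun x => (Φ x : Module.End ℝ (MvPolynomial (Fin d) ℝ)))
    (krallOperator_mul_intertwiner hα' hs hBψ hBf)
  simp only [map_mul, Subalgebra.coe_mul] at h
  rw [IsDarboux, h, ← Polynomial.aeval_algHom_apply Φ]
  congr 1
  rw [← hJ, show -absSum γ - (d : ℝ) = -(α + β + 1) by rw [hsum]; ring]
  refine (Polynomial.aeval_algHom_apply (algDhat γ).val _ f).symm.trans ?_
  congr 2
  simp
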